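/- Let $q\in\mathbb C$ with $0<|q|<1$, fix a square root $q^{1/2}$ of $q$ and put $q^{m/2}=(q^{1/2})^m$ for $m\in\mathbb Z$. Write $(a;q)_\infty=\prod_{n\ge 0}(1-aq^n)$ and $(a_1,\dots,a_r;q)_\infty=(a_1;q)_\infty\cdots(a_r;q)_\infty$. Let $a_1,\dots,a_4\in\mathbb C\setminus\{0\}$ satisfy $|a_1a_2a_3a_4|>|q|$, and let $b_1,\dots,b_4\in\mathbb C$ be generic in the sense that $b_jb_kq^n\neq 1$ for all $j,k\in\{1,\dots,4\}$ (including $j=k$) and all integers $n\ge 0$. Then for each $m\in\mathbb Z$ there is a positively oriented contour $C_m$ separating the poles $q^{k-m/2}b_j$ ($1\le j\le 4$, $k\ge 0$), which converge to $0$, from the poles $q^{-k-m/2}/b_j$ ($1\le j\le 4$, $b_j\ne 0$, $k\ge 0$), which go to infinity; that is, a closed piecewise $C^1$ curve that avoids $0$ and all these points, has winding number $1$ around $0$ and around each point of the first kind, and winding number $0$ around each point of the second kind. For any choice of such contours, $$\sum_{m=-\infty}^{\infty}\oint_{C_m}\prod_{j=1}^4\frac{(q^{1+m/2}/a_jz,\;q^{1-m/2}z/a_j;q)_\infty}{(q^{m/2}b_jz,\;q^{-m/2}b_j/z;q)_\infty}\;\frac{(1-q^mz^2)(1-q^mz^{-2})}{q^mz^{4m}}\;\frac{dz}{2\pi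 i z}=\frac{2\,(b_1b_2b_3b_4;q)_\infty}{(q/a_1a_2a_3a_4;q)_\infty}\prod_{1\le j<k\le 4}\frac{(q/a_ja_k;q)_\infty}{(b_jb_k;q)_\infty},$$ where the series on the left converges absolutely. -/

import Mathlib

/-- The infinite `q`-shifted factorial `(a; q)_∞ = ∏_{n ≥ 0} (1 - a q ^ n)`. -/
noncomputable def qPochInf (a q : ℂ) : ℂ := ∏' n : ℕ, (1 - a * q ^ n)

/-- The contour integral `∫_γ f(z) dz` of a complex function along a closed curve, i.e. the
curve integral of the one-form `f(z) dz`. -/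
noncomputable def contourIntegral (f : ℂ → ℂ) {p : ℂ} (γ : Path p p) : ℂ :=
  curveIntegral (fun z => f z • ContinuousLinearMap.id ℂ ℂ) γ

/-- The winding number of a closed curve around a point `w` off the curve. -/
noncomputable def windingNumber {p : ℂ} (γ : Path p p) (w : ℂ) : ℂ :=
  (2 * (Real.pi : ℂ) * Complex.I)⁻¹ * contourIntegral (fun z => (z - w)⁻¹) γ

/-- A curve is piecewise `C¹` if, for some finite set `P` of break points, it is `C¹`
(with one-sided derivatives at the end points) on every closed parameter interval with no
break point in its interior. -/
def IsPiecewiseC1 {p : ℂ} (γ : Path p p) : Prop :=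
  ∃ P : Finset ℝ, ∀ u v : ℝ, 0 ≤ u → u < v → v ≤ 1 → (∀ t ∈ P, t ∉ Set.Ioo u v) →
    ContDiffOn ℝ 1 γ.extend (Set.Icc u v)

/-- `γ` is a positively oriented contour separating the set `S` (inside) from the set `T`
(outside): a closed piecewise `C¹` curve that avoids both sets, winds once in the positive
sense around every point of `S`, and does not wind around any point of `T`. -/
structure IsSeparatingContour {p : ℂ} (γ : Path p p) (S T : Set ℂ) : Prop where
  piecewiseC1 : IsPiecewiseC1 γ
  avoids_inside : ∀ t, γ t ∉ S
  avoids_outside : ∀ t, γ t ∉ T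
  winding_inside : ∀ w ∈ S, windingNumber γ w = 1
  winding_outside : ∀ w ∈ T, windingNumber γ w = 0

/-- The integrand, without the measure `dz / (2 π i z)`. Here `s` is a square root of `q`, so that
`q ^ (m / 2)` is `s ^ m`. -/
noncomputable def wpIntegrand (q s : ℂ) (a b : Fin 4 → ℂ) (m : ℤ) (z : ℂ) : ℂ :=
  (∏ j : Fin 4,
    (qPochInf (q * s ^ m / (a j * z)) q * qPochInf (q * s ^ (-m) * z / a j) q) /
      (qPochInf (s ^ m * b j * z) q * qPochInf (s ^ (-m) * b j / z) q)) *
  ((1 - q ^ m * z ^ 2) * (1 - q ^ m * z ^ (-2 : ℤ)) / (q ^ m * z ^ (4 * m)))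

/-- The geometric sequences of poles `q ^ (k - m / 2) b_j`, `k ≥ 0`, which converge to `0`,
together with their limit `0`. -/
def polesToZero (q s : ℂ) (b : Fin 4 → ℂ) (m : ℤ) : Set ℂ :=
  {z | z = 0 ∨ ∃ (j : Fin 4) (k : ℕ), z = s ^ (-m) * b j * q ^ k}

/-- The geometric sequences of poles `q ^ (- k - m / 2) / b_j`, `k ≥ 0`, which go to infinity
(there are none for those `j` with `b_j = 0`). -/
def polesToInfinity (q s : ℂ) (b : Fin 4 → ℂ) (m : ℤ) : Set ℂ :=
  {z | ∃ (j : Fin 4) (k : ℕ), s ^ m * b j * z * q ^ k = 1}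

/-! ### The infinite q-shifted factorial. -/

section QPochhammer

variable {q : ℂ}

/-! Put `u = s ^ m z`. The half-integer powers disappear, the poles no longer depend on `m`, and one
contour serves for all terms (`wpIntegrand_eq`, `contourIntegral_wpIntegrand_eq`). Sum and integral
may then be exchanged. The sum over `m` is Bailey's very-well-poised bilateral sum with parameters
`1 / a_j`. It equals a constant times the same series with all parameters zero, a theta function of
`u` (`tsum_poisedTerm_eq`). What remains is the Askey–Wilson integral with parameters `b_j`
(`lineIntegral_awIntegrand_eq`). The two constants multiply to the right-hand side.

Both evaluations use one mechanism. A contiguous relation compares the parameters `a` and `q a`, up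
to an error that vanishes: a difference `D (m + 1) - D m` for the series, a difference `q F(q z) -
F(z)` for the integral. Iterating `a, q a, q ^ 2 a, ...` and passing to the limit replaces `a` by
`0` and produces infinite products (`mul_eq_mul_of_tendsto_of_recurrence`). Rotating the parameters
removes all four. The parameter-free series is never evaluated: it enters the integral as the theta
function, of which only the quasi-periodicity `poisedTheta_mul` and the termwise integral are
needed.

Contours are given only through winding numbers. Independence of the contour
(`lineIntegral_eq_of_isSeparatingContour`) follows by splitting off finitely many linear factors of
the denominator, representing the remaining holomorphic factor by Cauchy's formula on an annulus,
and treating the resulting rational integrands by partial fractions. A contour exists because only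
finitely many inner poles lie outside a small circle around `0`, and each can be added by a loop
(`exists_isSeparatingContour_innerPoles`). -/

theorem summable_norm_mul_pow (hq : ‖q‖ < 1) (a : ℂ) : Summable fun n : ℕ => ‖-(a * q ^ n)‖ := by
  simpa using (summable_geometric_of_lt_one (norm_nonneg q) hq).mul_left ‖a‖

theorem multipliable_qPochInf (hq : ‖q‖ < 1) (a : ℂ) : Multipliable fun n : ℕ => 1 - a * q ^ n := by
  simpa [sub_eq_add_neg] using multipliable_one_add_of_summable (summable_norm_mul_pow hq a)

theorem qPochInf_zero (q : ℂ) : qPochInf 0 q = 1 := by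
  simp [qPochInf]

theorem qPochInf_eq_one_sub_mul (hq : ‖q‖ < 1) (a : ℂ) :
    qPochInf a q = (1 - a) * qPochInf (a * q) q := by
  have e : ∀ n : ℕ, 1 - a * q * q ^ n = 1 - a * q ^ (n + 1) := fun n => by ring
  have h : Multipliable fun n : ℕ => 1 - a * q ^ (n + 1) :=
    (multipliable_qPochInf hq (a * q)).congr e
  have h2 := tprod_eq_zero_mul' (f := fun n : ℕ => 1 - a * q ^ n) h
  simp only [pow_zero, mul_one] at h2
  rw [qPochInf, qPochInf, h2, tprod_congr e]

theorem qPochInf_eq_prod_mul (hq : ‖q‖ < 1) (a : ℂ) (n : ℕ) :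
    qPochInf a q = (∏ i ∈ Finset.range n, (1 - a * q ^ i)) * qPochInf (a * q ^ n) q := by
  induction n with
  | zero => simp
  | succ n ih =>
    rw [Finset.prod_range_succ, ih, qPochInf_eq_one_sub_mul hq (a * q ^ n), pow_succ]
    ring_nf

theorem qPochInf_ne_zero (hq : ‖q‖ < 1) {a : ℂ} (h : ∀ n : ℕ, a * q ^ n ≠ 1) :
    qPochInf a q ≠ 0 := by
  have := tprod_one_add_ne_zero_of_summable (f := fun n : ℕ => -(a * q ^ n))
    (fun n => by simpa [← sub_eq_add_neg, sub_eq_zero] using (h n).symm)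
    (summable_norm_mul_pow hq a)
  simpa [qPochInf, sub_eq_add_neg] using this

theorem qPochInf_ne_zero_of_norm_lt_one (hq : ‖q‖ < 1) {a : ℂ} (h : ‖a‖ < 1) :
    qPochInf a q ≠ 0 := by
  refine qPochInf_ne_zero hq fun n hn => ?_
  have h1 : ‖a * q ^ n‖ ≤ ‖a‖ := by
    rw [norm_mul, norm_pow]
    exact mul_le_of_le_one_right (norm_nonneg a) (pow_le_one₀ (norm_nonneg q) hq.le)
  rw [hn, norm_one] at h1
  linarith

theorem differentiable_qPochInf (hq : ‖q‖ < 1) : Differentiable ℂ fun a => qPochInf a q := by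
  rw [← differentiableOn_univ]
  have key : HasProdLocallyUniformlyOn (fun (n : ℕ) (a : ℂ) => 1 + -(a * q ^ n))
      (fun a => ∏' n : ℕ, (1 + -(a * q ^ n))) Set.univ := by
    apply hasProdLocallyUniformlyOn_of_forall_compact isOpen_univ
    intro K _ hK
    obtain ⟨R, hR⟩ := hK.isBounded.exists_norm_le
    refine Summable.hasProdUniformlyOn_nat_one_add (u := fun n => R * ‖q‖ ^ n) hK
      ((summable_geometric_of_lt_one (norm_nonneg q) hq).mul_left R) (.of_forall fun n a ha => ?_)
      (fun n => by fun_prop)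
    rw [norm_neg, norm_mul, norm_pow]
    gcongr
    exact hR a ha
  have h2 := key.differentiableOn (.of_forall fun s => by fun_prop) isOpen_univ
  simpa [qPochInf, sub_eq_add_neg] using h2

theorem continuous_qPochInf (hq : ‖q‖ < 1) : Continuous fun a => qPochInf a q :=
  (differentiable_qPochInf hq).continuous

theorem exists_norm_qPochInf_le (hq : ‖q‖ < 1) (R : ℝ) :
    ∃ B : ℝ, 0 < B ∧ ∀ a : ℂ, ‖a‖ ≤ R → ‖qPochInf a q‖ ≤ B := by
  obtain ⟨B, hB⟩ := (isCompact_closedBall (0 : ℂ) R).exists_bound_of_continuousOn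
    (continuous_qPochInf hq).continuousOn
  refine ⟨max B 1, by positivity, fun a ha => (hB a ?_).trans (le_max_left _ _)⟩
  simpa using ha

/-- The finite products `∏_{i < n} (1 - a q ^ i)` converge to `(a; q)_∞`. -/
theorem tendsto_prod_qPochInf (hq : ‖q‖ < 1) (a : ℂ) :
    Filter.Tendsto (fun n : ℕ => ∏ i ∈ Finset.range n, (1 - a * q ^ i)) Filter.atTop
      (nhds (qPochInf a q)) :=
  (multipliable_qPochInf hq a).hasProd.tendsto_prod_nat

end QPochhammer

/-! ### Line integrals along piecewise C¹ paths. -/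

section LineIntegral

open MeasureTheory Set

/-- A path is piecewise `C¹` if, off a finite set of break points, it is `C¹` on closed parameter
intervals. -/
def PiecewiseC1Path {a b : ℂ} (γ : Path a b) : Prop :=
  ∃ P : Finset ℝ, ∀ u v : ℝ, 0 ≤ u → u < v → v ≤ 1 → (∀ t ∈ P, t ∉ Set.Ioo u v) →
    ContDiffOn ℝ 1 γ.extend (Set.Icc u v)

/-- The line integral `∫_γ f(z) dz` along a path with arbitrary end points. -/
noncomputable def lineIntegral (f : ℂ → ℂ) {a b : ℂ} (γ : Path a b) : ℂ :=
  curveIntegral (fun z => f z • ContinuousLinearMap.id ℂ ℂ) γ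

theorem contourIntegral_eq_lineIntegral (f : ℂ → ℂ) {p : ℂ} (γ : Path p p) :
    contourIntegral f γ = lineIntegral f γ := rfl

theorem lineIntegral_eq (f : ℂ → ℂ) {a b : ℂ} (γ : Path a b) :
    lineIntegral f γ = ∫ t in (0 : ℝ)..1, f (γ.extend t) * deriv γ.extend t := by
  simp [lineIntegral, curveIntegral_eq_intervalIntegral_deriv]

variable {a b c : ℂ} {γ : Path a b}

theorem extend_mem_range (γ : Path a b) (t : ℝ) : γ.extend t ∈ range γ := by
  rw [← γ.extend_range]
  exact mem_range_self t

/-- Cutting at an interior break point leaves fewer of them on either side, whence the strong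
induction. With none left, `deriv` agrees in the open interval with `derivWithin`, which is
continuous up to the end points. -/
theorem intervalIntegrable_deriv_of_breakpoints {g : ℝ → ℂ} {P : Finset ℝ} :
    ∀ (n : ℕ) (u v : ℝ), (P.filter (· ∈ Ioo u v)).card = n → u < v →
      (∀ u' v' : ℝ, u ≤ u' → u' < v' → v' ≤ v → (∀ t ∈ P, t ∉ Ioo u' v') →
        ContDiffOn ℝ 1 g (Icc u' v')) →
      IntervalIntegrable (deriv g) volume u v := by
  intro n
  induction n using Nat.strong_induction_on with
  | _ n ih =>
  intro u v hn huv h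
  by_cases hP : ∃ t ∈ P, t ∈ Ioo u v
  · obtain ⟨t, htP, ht⟩ := hP
    have hlt : ∀ u' v' : ℝ, u ≤ u' → v' ≤ v → t ∉ Ioo u' v' →
        (P.filter (· ∈ Ioo u' v')).card < n := by
      intro u' v' hu hv ht'
      rw [← hn]
      refine Finset.card_lt_card ⟨fun s hs => ?_, fun hs => ?_⟩
      · simp only [Finset.mem_filter, mem_Ioo] at hs ⊢
        exact ⟨hs.1, hu.trans_lt hs.2.1, hs.2.2.trans_le hv⟩
      · have : t ∈ P.filter (· ∈ Ioo u' v') := hs (by simp [htP, ht.1, ht.2])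
        exact ht' (Finset.mem_filter.1 this).2
    refine (ih _ (hlt u t le_rfl ht.2.le (by simp)) u t rfl ht.1 ?_).trans
      (ih _ (hlt t v ht.1.le le_rfl (by simp)) t v rfl ht.2 ?_)
    · exact fun u' v' h1 h2 h3 h4 => h u' v' h1 h2 (h3.trans ht.2.le) h4
    · exact fun u' v' h1 h2 h3 h4 => h u' v' (ht.1.le.trans h1) h2 h3 h4
  · push Not at hP
    have hc := h u v le_rfl huv le_rfl hP
    have h1 : IntervalIntegrable (derivWithin g (Icc u v)) volume u v :=
      (hc.continuousOn_derivWithin (uniqueDiffOn_Icc huv) le_rfl).intervalIntegrable_of_Icc huv.le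
    refine h1.congr_ae ?_
    rw [uIoc_of_le huv.le, ← restrict_Ioo_eq_restrict_Ioc]
    filter_upwards [ae_restrict_mem measurableSet_Ioo] with x hx
    exact derivWithin_of_mem_nhds (Icc_mem_nhds hx.1 hx.2)

theorem PiecewiseC1Path.intervalIntegrable_deriv (hγ : PiecewiseC1Path γ) :
    IntervalIntegrable (deriv γ.extend) volume 0 1 := by
  obtain ⟨P, hP⟩ := hγ
  exact intervalIntegrable_deriv_of_breakpoints _ 0 1 rfl one_pos hP

theorem PiecewiseC1Path.exists_differentiableAt (hγ : PiecewiseC1Path γ) :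
    ∃ P : Finset ℝ, ∀ t ∈ Ioo (0 : ℝ) 1 \ (P : Set ℝ), DifferentiableAt ℝ γ.extend t := by
  obtain ⟨P, hP⟩ := hγ
  refine ⟨P, fun t ht => ?_⟩
  have hopen : IsOpen (Ioo (0 : ℝ) 1 \ (P : Set ℝ)) := isOpen_Ioo.sdiff P.finite_toSet.isClosed
  obtain ⟨ε, hε, hball⟩ := Metric.isOpen_iff.1 hopen t ht
  have hsub : Icc (t - ε / 2) (t + ε / 2) ⊆ Ioo (0 : ℝ) 1 \ (P : Set ℝ) := by
    intro s hs
    refine hball ?_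
    rw [Metric.mem_ball, Real.dist_eq, abs_lt]
    constructor <;> linarith [hs.1, hs.2]
  have h0 := hsub (left_mem_Icc.2 (by linarith))
  have h1 := hsub (right_mem_Icc.2 (by linarith))
  have hc := hP (t - ε / 2) (t + ε / 2) h0.1.1.le (by linarith) h1.1.2.le
    fun s hs hs' => (hsub (Ioo_subset_Icc_self hs')).2 hs
  exact (hc.differentiableOn (by simp)).differentiableAt (Icc_mem_nhds (by linarith) (by linarith))

theorem continuous_comp_extend {f : ℂ → ℂ} (hf : ContinuousOn f (range γ)) :
    Continuous fun t => f (γ.extend t) :=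
  hf.comp_continuous γ.continuous_extend (extend_mem_range γ)

theorem PiecewiseC1Path.intervalIntegrable (hγ : PiecewiseC1Path γ) {f : ℂ → ℂ}
    (hf : ContinuousOn f (range γ)) :
    IntervalIntegrable (fun t => f (γ.extend t) * deriv γ.extend t) volume 0 1 :=
  hγ.intervalIntegrable_deriv.continuousOn_mul (continuous_comp_extend hf).continuousOn

theorem PiecewiseC1Path.curveIntegrable (hγ : PiecewiseC1Path γ) {f : ℂ → ℂ}
    (hf : ContinuousOn f (range γ)) :
    CurveIntegrable (fun z => f z • ContinuousLinearMap.id ℂ ℂ) γ := by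
  refine (hγ.intervalIntegrable hf).congr_ae ?_
  rw [uIoc_of_le zero_le_one, ← restrict_Ioo_eq_restrict_Ioc]
  filter_upwards [ae_restrict_mem measurableSet_Ioo] with x hx
  rw [curveIntegralFun_def, derivWithin_of_mem_nhds (Icc_mem_nhds hx.1 hx.2)]
  simp

theorem lineIntegral_congr {f g : ℂ → ℂ} (h : ∀ z ∈ range γ, f z = g z) :
    lineIntegral f γ = lineIntegral g γ := by
  simp only [lineIntegral_eq]
  exact intervalIntegral.integral_congr fun t _ => by simp only [h _ (extend_mem_range γ t)]

theorem lineIntegral_const_mul (k : ℂ) (f : ℂ → ℂ) (γ : Path a b) :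
    lineIntegral (fun z => k * f z) γ = k * lineIntegral f γ := by
  simp only [lineIntegral_eq, mul_assoc, intervalIntegral.integral_const_mul]

theorem lineIntegral_add (hγ : PiecewiseC1Path γ) {f g : ℂ → ℂ} (hf : ContinuousOn f (range γ))
    (hg : ContinuousOn g (range γ)) :
    lineIntegral (fun z => f z + g z) γ = lineIntegral f γ + lineIntegral g γ := by
  simp only [lineIntegral_eq, add_mul]
  exact intervalIntegral.integral_add (hγ.intervalIntegrable hf) (hγ.intervalIntegrable hg)

theorem lineIntegral_sub (hγ : PiecewiseC1Path γ) {f g : ℂ → ℂ} (hf : ContinuousOn f (range γ))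
    (hg : ContinuousOn g (range γ)) :
    lineIntegral (fun z => f z - g z) γ = lineIntegral f γ - lineIntegral g γ := by
  simp only [lineIntegral_eq, sub_mul]
  exact intervalIntegral.integral_sub (hγ.intervalIntegrable hf) (hγ.intervalIntegrable hg)

theorem lineIntegral_eq_sub_of_hasDerivAt (hγ : PiecewiseC1Path γ) {f F : ℂ → ℂ}
    (hf : ContinuousOn f (range γ)) (hF : ∀ z ∈ range γ, HasDerivAt F (f z) z) :
    lineIntegral f γ = F b - F a := by
  obtain ⟨P, hP⟩ := hγ.exists_differentiableAt
  have hFc : ContinuousOn F (range γ) := fun z hz => (hF z hz).continuousAt.continuousWithinAt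
  rw [lineIntegral_eq, integral_eq_of_hasDerivAt_off_countable_of_le
    (fun t => F (γ.extend t)) _ zero_le_one P.countable_toSet
    (continuous_comp_extend hFc).continuousOn ?_ (hγ.intervalIntegrable hf)]
  · simp
  · intro t ht
    exact (hF _ (extend_mem_range γ t)).comp_of_eq t (hP t ht).hasDerivAt rfl

theorem hasSum_lineIntegral (hγ : PiecewiseC1Path γ) {ι : Type*} [Countable ι] {F : ι → ℂ → ℂ}
    {u : ι → ℝ} (hu : Summable u) (hF : ∀ i, ContinuousOn (F i) (range γ))
    (hle : ∀ i, ∀ z ∈ range γ, ‖F i z‖ ≤ u i) :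
    HasSum (fun i => lineIntegral (F i) γ) (lineIntegral (fun z => ∑' i, F i z) γ) := by
  simp only [lineIntegral_eq]
  refine intervalIntegral.hasSum_integral_of_dominated_convergence
    (fun i t => u i * ‖deriv γ.extend t‖) ?_ ?_ ?_ ?_ ?_
  · intro i
    have := (hγ.intervalIntegrable (hF i)).aestronglyMeasurable
    rwa [uIoc_of_le zero_le_one]
  · refine fun i => .of_forall fun t _ => ?_
    rw [norm_mul]
    gcongr
    exact hle i _ (extend_mem_range γ t)
  · exact .of_forall fun t _ => hu.mul_right _
  · simp only [tsum_mul_right]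
    exact hγ.intervalIntegrable_deriv.norm.const_mul _
  · refine .of_forall fun t _ => ?_
    exact (Summable.of_norm_bounded hu
      fun i => hle i _ (extend_mem_range γ t)).hasSum.mul_right _

theorem tendsto_lineIntegral (hγ : PiecewiseC1Path γ) {F : ℕ → ℂ → ℂ} {f : ℂ → ℂ} {C : ℝ}
    (hF : ∀ n, ContinuousOn (F n) (range γ)) (hle : ∀ n, ∀ z ∈ range γ, ‖F n z‖ ≤ C)
    (hlim : ∀ z ∈ range γ, Filter.Tendsto (fun n => F n z) Filter.atTop (nhds (f z))) :
    Filter.Tendsto (fun n => lineIntegral (F n) γ) Filter.atTop (nhds (lineIntegral f γ)) := by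
  simp only [lineIntegral_eq]
  refine intervalIntegral.tendsto_integral_filter_of_dominated_convergence
    (fun t => C * ‖deriv γ.extend t‖) ?_ ?_ ?_ ?_
  · refine .of_forall fun n => ?_
    have := (hγ.intervalIntegrable (hF n)).aestronglyMeasurable
    rwa [uIoc_of_le zero_le_one]
  · refine .of_forall fun n => .of_forall fun t _ => ?_
    rw [norm_mul]
    gcongr
    exact hle n _ (extend_mem_range γ t)
  · exact hγ.intervalIntegrable_deriv.norm.const_mul _
  · exact .of_forall fun t _ => (hlim _ (extend_mem_range γ t)).mul_const _

theorem lineIntegral_symm (f : ℂ → ℂ) (γ : Path a b) :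
    lineIntegral f γ.symm = -lineIntegral f γ :=
  curveIntegral_symm _ _

theorem lineIntegral_trans {γ₁ : Path a b} {γ₂ : Path b c} (h₁ : PiecewiseC1Path γ₁)
    (h₂ : PiecewiseC1Path γ₂) {f : ℂ → ℂ} (hf₁ : ContinuousOn f (range γ₁))
    (hf₂ : ContinuousOn f (range γ₂)) :
    lineIntegral f (γ₁.trans γ₂) = lineIntegral f γ₁ + lineIntegral f γ₂ :=
  curveIntegral_trans (h₁.curveIntegrable hf₁) (h₂.curveIntegrable hf₂)

theorem PiecewiseC1Path.symm (hγ : PiecewiseC1Path γ) : PiecewiseC1Path γ.symm := by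
  obtain ⟨P, hP⟩ := hγ
  refine ⟨P.image fun t => 1 - t, fun u v hu huv hv h => ?_⟩
  rw [γ.extend_symm]
  refine (hP (1 - v) (1 - u) (by linarith) (by linarith) (by linarith) fun t ht ht' => ?_).comp
    (by fun_prop) fun t ht => ⟨by linarith [ht.2], by linarith [ht.1]⟩
  exact h (1 - t) (Finset.mem_image_of_mem _ ht) ⟨by linarith [ht'.2], by linarith [ht'.1]⟩

theorem PiecewiseC1Path.trans {γ₁ : Path a b} {γ₂ : Path b c} (h₁ : PiecewiseC1Path γ₁)
    (h₂ : PiecewiseC1Path γ₂) : PiecewiseC1Path (γ₁.trans γ₂) := by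
  obtain ⟨P, hP⟩ := h₁
  obtain ⟨Q, hQ⟩ := h₂
  -- The junction `1 / 2` is a new break point; the others are those of the two paths after
  -- reparametrization.
  refine ⟨insert (1 / 2) (P.image (fun t => t / 2) ∪ Q.image fun t => (t + 1) / 2),
    fun u v hu huv hv h => ?_⟩
  have hhalf : ¬ ((1 / 2 : ℝ) ∈ Ioo u v) := h _ (Finset.mem_insert_self _ _)
  rcases le_or_gt v (1 / 2) with hv' | hv'
  · have hc := (hP (2 * u) (2 * v) (by linarith) (by linarith) (by linarith)
      fun t ht ht' => ?_).comp (g := γ₁.extend) (f := fun t : ℝ => 2 * t) (s := Icc u v)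
        (by fun_prop) fun t ht => ⟨by linarith [ht.1], by linarith [ht.2]⟩
    · refine hc.congr fun t ht => ?_
      rw [Path.extend_trans_of_le_half _ _ (ht.2.trans hv')]
      rfl
    · refine h (t / 2) ?_ ⟨by linarith [ht'.1], by linarith [ht'.2]⟩
      simp only [Finset.mem_insert, Finset.mem_union, Finset.mem_image]
      exact Or.inr (Or.inl ⟨t, ht, rfl⟩)
  · have hu' : 1 / 2 ≤ u := by
      by_contra hlt
      exact hhalf ⟨not_le.1 hlt, hv'⟩
    have hc := (hQ (2 * u - 1) (2 * v - 1) (by linarith) (by linarith) (by linarith)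
      fun t ht ht' => ?_).comp (g := γ₂.extend) (f := fun t : ℝ => 2 * t - 1) (s := Icc u v)
        (by fun_prop) fun t ht => ⟨by linarith [ht.1], by linarith [ht.2]⟩
    · refine hc.congr fun t ht => ?_
      rw [Path.extend_trans_of_half_le _ _ (hu'.trans ht.1)]
      rfl
    · refine h ((t + 1) / 2) ?_ ⟨by linarith [ht'.1], by linarith [ht'.2]⟩
      simp only [Finset.mem_insert, Finset.mem_union, Finset.mem_image]
      exact Or.inr (Or.inr ⟨t, ht, rfl⟩)

theorem piecewiseC1Path_of_contDiffOn (h : ContDiffOn ℝ 1 γ.extend (Icc 0 1)) :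
    PiecewiseC1Path γ :=
  ⟨∅, fun _ _ hu _ hv _ => h.mono (Icc_subset_Icc hu hv)⟩

theorem piecewiseC1Path_segment (a b : ℂ) : PiecewiseC1Path (Path.segment a b) := by
  refine piecewiseC1Path_of_contDiffOn ?_
  have h : ContDiffOn ℝ 1 (fun t : ℝ => AffineMap.lineMap a b t) (Icc 0 1) := by
    simp only [AffineMap.lineMap_apply, vsub_eq_sub, vadd_eq_add]
    fun_prop
  exact h.congr fun t ht => by
    rw [Path.extend_apply _ ht]
    simp

/-- The image of a path under multiplication by a constant. -/
noncomputable def Path.mulLeft (k : ℂ) (γ : Path a b) : Path (k * a) (k * b) :=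
  γ.map (continuous_const_mul k)

theorem Path.extend_mulLeft (k : ℂ) (γ : Path a b) :
    (γ.mulLeft k).extend = fun t => k * γ.extend t := by
  ext t
  rfl

theorem PiecewiseC1Path.mulLeft (k : ℂ) (hγ : PiecewiseC1Path γ) :
    PiecewiseC1Path (γ.mulLeft k) := by
  obtain ⟨P, hP⟩ := hγ
  refine ⟨P, fun u v hu huv hv h => ?_⟩
  rw [Path.extend_mulLeft]
  exact contDiffOn_const.mul (hP u v hu huv hv h)

theorem lineIntegral_mulLeft (f : ℂ → ℂ) (k : ℂ) (γ : Path a b) :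
    lineIntegral f (γ.mulLeft k) = lineIntegral (fun z => k * f (k * z)) γ := by
  simp only [lineIntegral_eq, Path.extend_mulLeft, deriv_const_mul_field']
  exact intervalIntegral.integral_congr fun t _ => by ring

end LineIntegral

/-! ### Cauchy theory in terms of winding numbers. -/

section Cauchy

open MeasureTheory Set

variable {a p p' : ℂ} {γ : Path p p} {γ₁ : Path p p} {γ₂ : Path p' p'}

theorem continuousOn_sub_inv {w : ℂ} {s : Set ℂ} (hw : w ∉ s) :
    ContinuousOn (fun z : ℂ => (z - w)⁻¹) s :=
  ((continuous_id.sub continuous_const).continuousOn (s := s)).inv₀ fun z hz h =>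
    hw ((show z = w from sub_eq_zero.1 h) ▸ hz)

theorem continuousOn_prod_sub_inv {s : Multiset ℂ} {U : Set ℂ} (hw : ∀ w ∈ s, w ∉ U) :
    ContinuousOn (fun z : ℂ => (s.map fun w => (z - w)⁻¹).prod) U := by
  induction s using Multiset.induction with
  | empty => simpa using continuousOn_const
  | cons w s ih =>
    simp only [Multiset.map_cons, Multiset.prod_cons]
    exact (continuousOn_sub_inv (hw w (by simp))).mul
      (ih fun v hv => hw v (Multiset.mem_cons_of_mem hv))

theorem lineIntegral_sub_inv_pow_eq_zero (hγ : PiecewiseC1Path γ) {w : ℂ} (hw : w ∉ range γ)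
    {n : ℕ} (hn : n ≠ 1) : lineIntegral (fun z => ((z - w)⁻¹) ^ n) γ = 0 := by
  have hn' : (1 - n : ℂ) ≠ 0 := by
    rw [sub_ne_zero]
    exact_mod_cast hn.symm
  rw [lineIntegral_eq_sub_of_hasDerivAt hγ (f := fun z => ((z - w)⁻¹) ^ n)
    ((continuousOn_sub_inv hw).pow n)
    (F := fun z => (z - w) ^ (1 - n : ℤ) / (1 - n))]
  · ring
  · intro z hz
    have hzw : z - w ≠ 0 := fun h => hw ((sub_eq_zero.1 h) ▸ hz)
    have := ((hasDerivAt_zpow (1 - n : ℤ) (z - w) (Or.inl hzw)).comp_sub_const z w).div_const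
      (1 - n : ℂ)
    have e : ((1 - n : ℤ) : ℂ) * (z - w) ^ (1 - n - 1 : ℤ) / (1 - n) = ((z - w)⁻¹) ^ n := by
      push_cast
      rw [mul_div_right_comm, div_self hn', one_mul, show (1 - n - 1 : ℤ) = -n by ring,
        zpow_neg, zpow_natCast, inv_pow]
    rwa [e] at this

/-- Integrals of rational functions along closed curves only depend on the winding numbers of the
curve around the poles. -/
theorem lineIntegral_prod_sub_inv_eq (h₁ : PiecewiseC1Path γ₁) (h₂ : PiecewiseC1Path γ₂) :
    ∀ (n : ℕ) (s : Multiset ℂ), s.card = n →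
      (∀ w ∈ s, w ∉ range γ₁ ∧ w ∉ range γ₂ ∧
        lineIntegral (fun z => (z - w)⁻¹) γ₁ = lineIntegral (fun z => (z - w)⁻¹) γ₂) →
      lineIntegral (fun z => (s.map fun w => (z - w)⁻¹).prod) γ₁ =
        lineIntegral (fun z => (s.map fun w => (z - w)⁻¹).prod) γ₂ := by
  intro n
  induction n with
  | zero =>
    intro s hs _
    rw [Multiset.card_eq_zero] at hs
    subst hs
    simp only [Multiset.map_zero, Multiset.prod_zero]
    rw [lineIntegral_eq_sub_of_hasDerivAt h₁ continuousOn_const fun z _ => hasDerivAt_id z,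
      lineIntegral_eq_sub_of_hasDerivAt h₂ continuousOn_const fun z _ => hasDerivAt_id z]
    simp
  | succ n ih =>
    intro s hs hw
    obtain ⟨w, hws⟩ := Multiset.card_pos_iff_exists_mem.1 (by omega : 0 < s.card)
    obtain ⟨t, rfl⟩ := Multiset.exists_cons_of_mem hws
    -- Two distinct poles are separated by partial fractions, which lowers the number of factors. If
    -- all poles coincide, the integrand is a power of `(z - w)⁻¹`, with a primitive unless the
    -- exponent is `1`.
    by_cases ht : ∃ w' ∈ t, w' ≠ w
    · obtain ⟨w', hw't, hne⟩ := ht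
      obtain ⟨t, rfl⟩ := Multiset.exists_cons_of_mem hw't
      have key : ∀ z, z ≠ w → z ≠ w' →
          ((w ::ₘ w' ::ₘ t).map fun w => (z - w)⁻¹).prod =
            (w - w')⁻¹ * (((w ::ₘ t).map fun w => (z - w)⁻¹).prod -
              ((w' ::ₘ t).map fun w => (z - w)⁻¹).prod) := by
        intro z h1 h2
        simp only [Multiset.map_cons, Multiset.prod_cons]
        have h1' := sub_ne_zero.2 h1
        have h2' := sub_ne_zero.2 h2
        have h3' := sub_ne_zero.2 hne.symm
        rw [← sub_mul, ← mul_assoc, ← mul_assoc]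
        congr 1
        field_simp
        ring
      have hsub1 : ∀ v ∈ w ::ₘ t, v ∈ w ::ₘ w' ::ₘ t := fun v hv => by
        simp only [Multiset.mem_cons] at hv ⊢
        tauto
      have hsub2 : ∀ v ∈ w' ::ₘ t, v ∈ w ::ₘ w' ::ₘ t := fun v hv =>
        Multiset.mem_cons_of_mem hv
      have hwm : w ∈ w ::ₘ w' ::ₘ t := by simp
      have hwm' : w' ∈ w ::ₘ w' ::ₘ t := by simp
      have e1 := ih (w ::ₘ t) (by simpa using hs) fun v hv => hw v (hsub1 v hv)
      have e2 := ih (w' ::ₘ t) (by simpa using hs) fun v hv => hw v (hsub2 v hv)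
      rw [lineIntegral_congr fun z hz => key z (fun h => (hw w hwm).1 (h ▸ hz))
          (fun h => (hw w' hwm').1 (h ▸ hz)),
        lineIntegral_congr (γ := γ₂) fun z hz => key z (fun h => (hw w hwm).2.1 (h ▸ hz))
          (fun h => (hw w' hwm').2.1 (h ▸ hz)),
        lineIntegral_const_mul, lineIntegral_const_mul,
        lineIntegral_sub h₁ (continuousOn_prod_sub_inv fun v hv => (hw v (hsub1 v hv)).1)
          (continuousOn_prod_sub_inv fun v hv => (hw v (hsub2 v hv)).1),
        lineIntegral_sub h₂ (continuousOn_prod_sub_inv fun v hv => (hw v (hsub1 v hv)).2.1)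
          (continuousOn_prod_sub_inv fun v hv => (hw v (hsub2 v hv)).2.1), e1, e2]
    · push Not at ht
      have hrep : w ::ₘ t = Multiset.replicate (n + 1) w := by
        rw [Multiset.eq_replicate]
        refine ⟨hs, fun v hv => ?_⟩
        rcases Multiset.mem_cons.1 hv with h | h
        exacts [h, ht v h]
      have hw' := hw w (by simp)
      rw [hrep]
      simp only [Multiset.map_replicate, Multiset.prod_replicate]
      by_cases hn : n + 1 = 1
      · simpa [hn] using hw'.2.2
      · rw [lineIntegral_sub_inv_pow_eq_zero h₁ hw'.1 hn,
          lineIntegral_sub_inv_pow_eq_zero h₂ hw'.2.1 hn]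

theorem one_sub_mem_slitPlane {x : ℂ} (hx : ‖x‖ < 1) : 1 - x ∈ Complex.slitPlane := by
  simpa [sub_eq_add_neg] using Complex.mem_slitPlane_of_norm_lt_one (z := -x) (by simpa using hx)

/-- For `|z| < |w|` the number `1 - z / w` stays in the slit plane, so `log (1 - z / w)` is a
primitive. -/
theorem lineIntegral_sub_inv_eq_zero_of_norm_lt (hγ : PiecewiseC1Path γ) {w : ℂ}
    (hw : ∀ z ∈ range γ, ‖z‖ < ‖w‖) : lineIntegral (fun z => (z - w)⁻¹) γ = 0 := by
  rw [lineIntegral_eq_sub_of_hasDerivAt hγ (continuousOn_sub_inv fun h => (hw w h).ne rfl)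
    (F := fun z => Complex.log (1 - z / w)), sub_self]
  intro z hz
  have hw0 : w ≠ 0 := norm_pos_iff.1 ((norm_nonneg z).trans_lt (hw z hz))
  have hzw : z - w ≠ 0 := fun h => (hw z hz).ne (by rw [sub_eq_zero.1 h])
  have hlt : ‖z / w‖ < 1 := by
    rw [norm_div, div_lt_one (norm_pos_iff.2 hw0)]
    exact hw z hz
  have := (((hasDerivAt_id z).div_const w).const_sub 1).clog (one_sub_mem_slitPlane hlt)
  have h1 : 1 - z / w ≠ 0 := Complex.slitPlane_ne_zero (one_sub_mem_slitPlane hlt)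
  have h2 : -(1 / w) / (1 - z / w) = (z - w)⁻¹ := by
    rw [div_eq_iff h1]
    field_simp
    ring
  simpa only [id, h2] using this

/-- The difference of the two integrands has the primitive `log (1 - w / z)`, which is single-valued
on `|z| > |w|`. -/
theorem lineIntegral_sub_inv_eq_of_lt_norm (hγ : PiecewiseC1Path γ) {w : ℂ}
    (hw : ∀ z ∈ range γ, ‖w‖ < ‖z‖) :
    lineIntegral (fun z => (z - w)⁻¹) γ = lineIntegral (fun z => (z - 0)⁻¹) γ := by
  have hc1 : ContinuousOn (fun z : ℂ => (z - w)⁻¹) (range γ) :=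
    continuousOn_sub_inv fun h => (hw w h).ne rfl
  have hc0 : ContinuousOn (fun z : ℂ => (z - 0)⁻¹) (range γ) :=
    continuousOn_sub_inv fun h => ((norm_nonneg w).trans_lt (hw 0 h)).ne' norm_zero
  rw [← sub_eq_zero, ← lineIntegral_sub hγ hc1 hc0,
    lineIntegral_eq_sub_of_hasDerivAt hγ (f := fun z => (z - w)⁻¹ - (z - 0)⁻¹) (hc1.sub hc0)
      (F := fun z => Complex.log (1 - w / z)), sub_self]
  intro z hz
  have hz0 : z ≠ 0 := norm_pos_iff.1 ((norm_nonneg w).trans_lt (hw z hz))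
  have hzw : z - w ≠ 0 := fun h => (hw z hz).ne' (by rw [sub_eq_zero.1 h])
  have hlt : ‖w / z‖ < 1 := by
    rw [norm_div, div_lt_one (norm_pos_iff.2 hz0)]
    exact hw z hz
  have := (((hasDerivAt_inv hz0).const_mul w).const_sub 1).clog
    (one_sub_mem_slitPlane (by rwa [div_eq_mul_inv] at hlt))
  have h1 : 1 - w / z ≠ 0 := Complex.slitPlane_ne_zero (one_sub_mem_slitPlane hlt)
  have h2 : -(w * -(z ^ 2)⁻¹) / (1 - w / z) = (z - w)⁻¹ - (z - 0)⁻¹ := by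
    rw [div_eq_iff h1, sub_zero]
    field_simp
    ring
  simpa only [← div_eq_mul_inv w, h2] using this

/-- Cauchy's integral formula for an annulus. -/
theorem circleIntegral_sub_circleIntegral_of_annulus {h : ℂ → ℂ} {r R : ℝ} (hr : 0 < r) {w : ℂ}
    (hrw : r < ‖w‖) (hwR : ‖w‖ < R)
    (hh : ∀ z : ℂ, r ≤ ‖z‖ → ‖z‖ ≤ R → DifferentiableAt ℂ h z) :
    (∮ ζ in C(0, R), (ζ - w)⁻¹ * h ζ) - (∮ ζ in C(0, r), (ζ - w)⁻¹ * h ζ) =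
      2 * Real.pi * Complex.I * h w := by
  have hR : 0 < R := hr.trans (hrw.trans hwR)
  -- Cauchy's theorem is applied to `(h ζ - h w) / (ζ - w)`, whose singularity at `w` is removable.
  -- The subtracted term integrates to `2 π i h w` on the outer circle and to `0` on the inner one.
  have hdiff : ∀ ρ : ℝ, 0 < ρ → r ≤ ρ → ρ ≤ R → ρ ≠ ‖w‖ →
      (∮ ζ in C(0, ρ), dslope h w ζ) =
        (∮ ζ in C(0, ρ), (ζ - w)⁻¹ * h ζ) - h w * ∮ ζ in C(0, ρ), (ζ - w)⁻¹ := by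
    intro ρ hρ h1 h2 hne
    have hws : w ∉ Metric.sphere (0 : ℂ) ρ := fun hm => hne (by simpa using hm.symm)
    have hc : ContinuousOn (fun ζ : ℂ => (ζ - w)⁻¹) (Metric.sphere 0 ρ) :=
      continuousOn_sub_inv hws
    have hch : ContinuousOn h (Metric.sphere 0 ρ) := fun z hz => by
      have : ‖z‖ = ρ := by simpa using hz
      exact (hh z (by rw [this]; exact h1) (by rw [this]; exact h2)).continuousAt.continuousWithinAt
    have hi1 : CircleIntegrable (fun ζ => (ζ - w)⁻¹ * h ζ) 0 ρ :=
      (hc.mul hch).circleIntegrable hρ.le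
    have hi2 : CircleIntegrable (fun ζ => h w * (ζ - w)⁻¹) 0 ρ :=
      (continuousOn_const.mul hc).circleIntegrable hρ.le
    rw [← circleIntegral.integral_const_mul, ← circleIntegral.integral_sub hi1 hi2]
    refine circleIntegral.integral_congr hρ.le fun z hz => ?_
    have hzw : z ≠ w := fun hzw => hws (hzw ▸ hz)
    simp only [dslope_of_ne _ hzw, slope_def_field]
    ring
  have hw' : DifferentiableAt ℂ h w := hh w hrw.le hwR.le
  have hd : ∀ z ∈ (Metric.ball (0 : ℂ) R \ Metric.closedBall 0 r) \ {w},
      DifferentiableAt ℂ (dslope h w) z := by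
    intro z hz
    have hzw : z ≠ w := by simpa using hz.2
    rw [differentiableAt_dslope_of_ne hzw]
    have h1 := hz.1.1
    have h2 := hz.1.2
    simp only [Metric.mem_ball, Metric.mem_closedBall, dist_zero_right, not_le] at h1 h2
    exact hh z h2.le h1.le
  have hc : ContinuousOn (dslope h w) (Metric.closedBall 0 R \ Metric.ball 0 r) := by
    intro z hz
    have h1 := hz.1
    have h2 := hz.2
    simp only [Metric.mem_ball, Metric.mem_closedBall, dist_zero_right, not_lt] at h1 h2
    refine ContinuousAt.continuousWithinAt ?_
    by_cases hzw : z = w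
    · subst hzw
      exact continuousAt_dslope_same.2 hw'
    · exact (continuousAt_dslope_of_ne hzw).2 (hh z h2 h1).continuousAt
  have e := Complex.circleIntegral_eq_of_differentiable_on_annulus_off_countable hr
    (hrw.trans hwR).le (countable_singleton w) hc hd
  rw [hdiff R hR (hrw.trans hwR).le le_rfl hwR.ne', hdiff r hr le_rfl (hrw.trans hwR).le hrw.ne,
    circleIntegral.integral_sub_inv_of_mem_ball (by simpa using hwR)] at e
  have e0 : (∮ ζ in C(0, r), (ζ - w)⁻¹) = 0 := by
    refine Complex.circleIntegral_eq_zero_of_differentiable_on_off_countable hr.le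
      countable_empty (continuousOn_sub_inv (by simpa using hrw)) fun z hz => ?_
    have hz' : ‖z‖ < r := by simpa using hz.1
    have : z - w ≠ 0 := fun h => (hz'.trans hrw).ne (by rw [sub_eq_zero.1 h])
    fun_prop (disch := assumption)
  rw [e0] at e
  linear_combination e

theorem lineIntegral_circleIntegral_swap (hγ : PiecewiseC1Path γ) {ρ : ℝ} (hρ : 0 ≤ ρ)
    {K : ℂ → ℂ → ℂ}
    (hK : ContinuousOn (Function.uncurry K) (Metric.sphere (0 : ℂ) ρ ×ˢ range γ)) :
    lineIntegral (fun w => ∮ ζ in C(0, ρ), K ζ w) γ =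
      ∮ ζ in C(0, ρ), lineIntegral (K ζ) γ := by
  simp only [lineIntegral_eq, circleIntegral, smul_eq_mul]
  simp only [← intervalIntegral.integral_mul_const, ← intervalIntegral.integral_const_mul]
  rw [intervalIntegral_intervalIntegral_swap]
  · simp only [mul_assoc]
  · have hcont : Continuous fun x : ℝ × ℝ =>
        deriv (circleMap 0 ρ) x.2 * K (circleMap 0 ρ x.2) (γ.extend x.1) := by
      simp only [deriv_circleMap]
      refine Continuous.mul (by fun_prop) ?_
      exact hK.comp_continuous (f := fun x : ℝ × ℝ => (circleMap 0 ρ x.2, γ.extend x.1))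
        (by fun_prop) fun x => ⟨circleMap_mem_sphere 0 hρ x.2, extend_mem_range γ x.1⟩
    have : IsFiniteMeasure (volume.restrict (uIoc 0 (2 * Real.pi))) := by
      rw [uIoc_of_le (by positivity)]
      infer_instance
    have hint : Integrable (fun x : ℝ × ℝ => deriv γ.extend x.1)
        ((volume.restrict (uIoc 0 1)).prod (volume.restrict (uIoc 0 (2 * Real.pi)))) :=
      (intervalIntegrable_iff.1 hγ.intervalIntegrable_deriv).comp_fst _
    obtain ⟨B, hB⟩ := ((isCompact_Icc (a := (0 : ℝ)) (b := 1)).prod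
      (isCompact_Icc (a := (0 : ℝ)) (b := 2 * Real.pi))).exists_bound_of_continuousOn
      hcont.continuousOn
    rw [IntegrableOn, Measure.volume_eq_prod, ← Measure.prod_restrict]
    -- The derivative of the path is merely integrable; the kernel is bounded by compactness.
    refine Integrable.bdd_mul hint hcont.aestronglyMeasurable (c := B) ?_
    rw [Measure.prod_restrict]
    filter_upwards [ae_restrict_mem (measurableSet_uIoc.prod measurableSet_uIoc)] with x hx
    refine hB x ?_
    rw [uIoc_of_le zero_le_one, uIoc_of_le (by positivity)] at hx
    exact ⟨Ioc_subset_Icc_self hx.1, Ioc_subset_Icc_self hx.2⟩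

/-- Insert Cauchy's formula for `h` and exchange the integrals. Then `h` is replaced by kernels `(w
- ζ)⁻¹` with `ζ` on the boundary circles, off the curve, so a rational `G` leaves only rational
inner integrands. -/
theorem lineIntegral_annulus_eq (hγ : PiecewiseC1Path γ) {h G : ℂ → ℂ} {r R : ℝ} (hr : 0 < r)
    (hγr : ∀ z ∈ range γ, r < ‖z‖ ∧ ‖z‖ < R)
    (hh : ∀ z : ℂ, r ≤ ‖z‖ → ‖z‖ ≤ R → DifferentiableAt ℂ h z) (hG : ContinuousOn G (range γ)) :
    2 * Real.pi * Complex.I * lineIntegral (fun z => h z * G z) γ =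
      (∮ ζ in C(0, R), -h ζ * lineIntegral (fun w => (w - ζ)⁻¹ * G w) γ) -
        ∮ ζ in C(0, r), -h ζ * lineIntegral (fun w => (w - ζ)⁻¹ * G w) γ := by
  have hrR : r < R := (hγr p ⟨0, by simp⟩).1.trans (hγr p ⟨0, by simp⟩).2
  have key : ∀ ρ : ℝ, r ≤ ρ → ρ ≤ R → ρ ∉ (‖·‖) '' range γ →
      ContinuousOn (fun w => (∮ ζ in C(0, ρ), (ζ - w)⁻¹ * h ζ) * G w) (range γ) ∧
      (∮ ζ in C(0, ρ), -h ζ * lineIntegral (fun w => (w - ζ)⁻¹ * G w) γ) =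
        lineIntegral (fun w => (∮ ζ in C(0, ρ), (ζ - w)⁻¹ * h ζ) * G w) γ := by
    intro ρ h1 h2 h3
    have hρ : 0 ≤ ρ := hr.le.trans h1
    have hch : ContinuousOn h (Metric.sphere 0 ρ) := fun z hz => by
      have : ‖z‖ = ρ := by simpa using hz
      exact (hh z (by rw [this]; exact h1) (by rw [this]; exact h2)).continuousAt.continuousWithinAt
    have hcK : ContinuousOn (fun x : ℂ × ℂ => (x.1 - x.2)⁻¹ * h x.1)
        (Metric.sphere (0 : ℂ) ρ ×ˢ range γ) := by
      refine ContinuousOn.mul ((continuousOn_fst.sub continuousOn_snd).inv₀ fun x hx h0 => h3 ?_)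
        (hch.comp continuousOn_fst fun x hx => hx.1)
      exact ⟨x.2, hx.2, by simpa [sub_eq_zero.1 h0] using hx.1⟩
    refine ⟨?_, ?_⟩
    · refine ContinuousOn.mul ?_ hG
      rw [continuousOn_iff_continuous_domRestrict]
      simp only [circleIntegral, deriv_circleMap, smul_eq_mul, domRestrict_def]
      refine intervalIntegral.continuous_parametric_intervalIntegral_of_continuous' ?_ 0 _
      simp only [Function.uncurry_def]
      refine Continuous.mul (by fun_prop) ?_
      exact hcK.comp_continuous (f := fun x : range γ × ℝ => (circleMap 0 ρ x.2, (x.1 : ℂ)))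
        (by fun_prop) fun x => ⟨circleMap_mem_sphere 0 hρ x.2, x.1.2⟩
    · have := lineIntegral_circleIntegral_swap hγ hρ
        (K := fun ζ w => ((ζ - w)⁻¹ * h ζ) * G w)
        (hcK.mul (hG.comp continuousOn_snd fun x hx => hx.2))
      rw [lineIntegral_congr (g := fun w => (∮ ζ in C(0, ρ), (ζ - w)⁻¹ * h ζ * G w))]
      · rw [this]
        refine circleIntegral.integral_congr hρ fun ζ _ => ?_
        rw [← lineIntegral_const_mul]
        refine lineIntegral_congr fun w _ => ?_
        rw [← neg_sub w ζ, inv_neg]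
        ring
      · intro w _
        simp only [mul_comm _ (G w), circleIntegral.integral_const_mul]
  obtain ⟨c1, e1⟩ := key R hrR.le le_rfl (by rintro ⟨z, hz, h⟩; exact (hγr z hz).2.ne h)
  obtain ⟨c2, e2⟩ := key r le_rfl hrR.le (by rintro ⟨z, hz, h⟩; exact (hγr z hz).1.ne' h)
  rw [e1, e2, ← lineIntegral_const_mul, ← lineIntegral_sub hγ c1 c2]
  refine lineIntegral_congr fun w hw => ?_
  rw [← sub_mul, circleIntegral_sub_circleIntegral_of_annulus hr (hγr w hw).1 (hγr w hw).2 hh]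
  ring

/-- Integrals of `h / ∏ (z - w)` along closed curves in an annulus on which `h` is holomorphic only
depend on the winding numbers of the curve around `0` and around the points `w`. -/
theorem lineIntegral_mul_prod_sub_inv_eq (h₁ : PiecewiseC1Path γ₁) (h₂ : PiecewiseC1Path γ₂)
    {h : ℂ → ℂ} {r R : ℝ} (hr : 0 < r) (hγ₁ : ∀ z ∈ range γ₁, r < ‖z‖ ∧ ‖z‖ < R)
    (hγ₂ : ∀ z ∈ range γ₂, r < ‖z‖ ∧ ‖z‖ < R)
    (hh : ∀ z : ℂ, r ≤ ‖z‖ → ‖z‖ ≤ R → DifferentiableAt ℂ h z)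
    (h0 : lineIntegral (fun z => (z - 0)⁻¹) γ₁ = lineIntegral (fun z => (z - 0)⁻¹) γ₂)
    {s : Multiset ℂ}
    (hs : ∀ w ∈ s, w ∉ range γ₁ ∧ w ∉ range γ₂ ∧
      lineIntegral (fun z => (z - w)⁻¹) γ₁ = lineIntegral (fun z => (z - w)⁻¹) γ₂) :
    lineIntegral (fun z => h z * (s.map fun w => (z - w)⁻¹).prod) γ₁ =
      lineIntegral (fun z => h z * (s.map fun w => (z - w)⁻¹).prod) γ₂ := by
  have hrR : r < R := (hγ₁ p ⟨0, by simp⟩).1.trans (hγ₁ p ⟨0, by simp⟩).2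
  -- A boundary point `ζ` is one more simple pole: on the inner circle both curves wind around it as
  -- around `0`, on the outer circle neither winds around it.
  have key : ∀ ζ : ℂ, ‖ζ‖ = r ∨ ‖ζ‖ = R →
      lineIntegral (fun w => (w - ζ)⁻¹ * (s.map fun v => (w - v)⁻¹).prod) γ₁ =
        lineIntegral (fun w => (w - ζ)⁻¹ * (s.map fun v => (w - v)⁻¹).prod) γ₂ := by
    intro ζ hζ
    have := lineIntegral_prod_sub_inv_eq h₁ h₂ _ (ζ ::ₘ s) rfl fun w hw => ?_
    · simpa only [Multiset.map_cons, Multiset.prod_cons] using this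
    · rcases Multiset.mem_cons.1 hw with rfl | hw
      · rcases hζ with hζ | hζ
        · refine ⟨fun hm => (hγ₁ w hm).1.ne' hζ, fun hm => (hγ₂ w hm).1.ne' hζ, ?_⟩
          rw [lineIntegral_sub_inv_eq_of_lt_norm h₁ fun z hz => hζ ▸ (hγ₁ z hz).1,
            lineIntegral_sub_inv_eq_of_lt_norm h₂ fun z hz => hζ ▸ (hγ₂ z hz).1, h0]
        · refine ⟨fun hm => (hγ₁ w hm).2.ne hζ, fun hm => (hγ₂ w hm).2.ne hζ, ?_⟩
          rw [lineIntegral_sub_inv_eq_zero_of_norm_lt h₁ fun z hz => hζ ▸ (hγ₁ z hz).2,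
            lineIntegral_sub_inv_eq_zero_of_norm_lt h₂ fun z hz => hζ ▸ (hγ₂ z hz).2]
      · exact hs w hw
  have e1 := lineIntegral_annulus_eq h₁ hr hγ₁ hh
    (continuousOn_prod_sub_inv fun w hw => (hs w hw).1)
  have e2 := lineIntegral_annulus_eq h₂ hr hγ₂ hh
    (continuousOn_prod_sub_inv fun w hw => (hs w hw).2.1)
  refine mul_left_cancel₀ Complex.two_pi_I_ne_zero ?_
  rw [e1, e2]
  congr 1
  · refine circleIntegral.integral_congr (hr.trans hrR).le fun ζ hζ => ?_
    have hζ' : ‖ζ‖ = R := by simpa using hζ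
    simp only [key ζ (Or.inr hζ')]
  · refine circleIntegral.integral_congr hr.le fun ζ hζ => ?_
    have hζ' : ‖ζ‖ = r := by simpa using hζ
    simp only [key ζ (Or.inl hζ')]

/-- Factors with `β i = 0` go into the constant `C`. If also `α i = 0`, the convention `0⁻¹ = 0`
keeps the identity true. -/
theorem exists_prod_linear_inv_eq {ι : Type*} (t : Finset ι) (α β : ι → ℂ) :
    ∃ (C : ℂ) (s : Multiset ℂ), (∀ w ∈ s, ∃ i, α i + β i * w = 0) ∧
      ∀ z, (∏ i ∈ t, (α i + β i * z))⁻¹ = C * (s.map fun w => (z - w)⁻¹).prod := by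
  classical
  induction t using Finset.induction with
  | empty => exact ⟨1, 0, by simp, by simp⟩
  | insert i t hi ih =>
    obtain ⟨C, s, hs, e⟩ := ih
    by_cases hβ : β i = 0
    · refine ⟨(α i)⁻¹ * C, s, hs, fun z => ?_⟩
      rw [Finset.prod_insert hi, mul_inv, e z, hβ]
      ring
    · refine ⟨(β i)⁻¹ * C, (-α i / β i) ::ₘ s, fun w hw => ?_, fun z => ?_⟩
      · rcases Multiset.mem_cons.1 hw with rfl | hw
        · refine ⟨i, ?_⟩
          field_simp
          ring
        · exact hs w hw
      · rw [Finset.prod_insert hi, mul_inv, e z, Multiset.map_cons, Multiset.prod_cons,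
          show α i + β i * z = β i * (z - -α i / β i) by field_simp; ring, mul_inv]
        ring

theorem exists_norm_bounds_of_zero_notMem (γ : Path p p') (h : (0 : ℂ) ∉ range γ) :
    ∃ r R : ℝ, 0 < r ∧ ∀ z ∈ range γ, r < ‖z‖ ∧ ‖z‖ < R := by
  have hc : IsCompact (range γ) := isCompact_range γ.continuous
  obtain ⟨R, hR⟩ := hc.isBounded.exists_norm_le
  obtain ⟨z₀, hz₀, hmin⟩ := hc.exists_isMinOn ⟨p, 0, by simp⟩
    (continuous_norm.continuousOn (s := range γ))
  have hpos : 0 < ‖z₀‖ := norm_pos_iff.2 fun h0 => h (h0 ▸ hz₀)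
  refine ⟨‖z₀‖ / 2, R + 1, by positivity, fun z hz => ⟨?_, ?_⟩⟩
  · have : ‖z₀‖ ≤ ‖z‖ := hmin hz
    linarith
  · linarith [hR z hz]

end Cauchy

/-! ### Independence of the separating contour. -/

section SeparatingContours

open Set

variable {q : ℂ} {b c : Fin 4 → ℂ} {p p' : ℂ} {γ₁ : Path p p} {γ₂ : Path p' p'}

/-- The geometric sequences `c_j q ^ k` together with their limit `0`. -/
def innerPoles (q : ℂ) (c : Fin 4 → ℂ) : Set ℂ :=
  {z | z = 0 ∨ ∃ (j : Fin 4) (k : ℕ), z = c j * q ^ k}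

/-- The geometric sequences `q ^ (-k) / b_j`. -/
def outerPoles (q : ℂ) (b : Fin 4 → ℂ) : Set ℂ :=
  {z | ∃ (j : Fin 4) (k : ℕ), b j * z * q ^ k = 1}

theorem IsSeparatingContour.piecewiseC1Path {S T : Set ℂ} (h : IsSeparatingContour γ₁ S T) :
    PiecewiseC1Path γ₁ := h.piecewiseC1

theorem windingNumber_eq (γ : Path p p) (w : ℂ) : windingNumber γ w =
    (2 * (Real.pi : ℂ) * Complex.I)⁻¹ * lineIntegral (fun z => (z - w)⁻¹) γ := rfl

theorem lineIntegral_sub_inv_eq_of_windingNumber_eq {w : ℂ}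
    (h : windingNumber γ₁ w = windingNumber γ₂ w) :
    lineIntegral (fun z => (z - w)⁻¹) γ₁ = lineIntegral (fun z => (z - w)⁻¹) γ₂ :=
  mul_left_cancel₀ (inv_ne_zero Complex.two_pi_I_ne_zero) h

theorem IsSeparatingContour.ne_zero (h : IsSeparatingContour γ₁ (innerPoles q c) (outerPoles q b))
    {z : ℂ} (hz : z ∈ range γ₁) : z ≠ 0 := by
  rintro rfl
  obtain ⟨t, ht⟩ := hz
  exact h.avoids_inside t (ht ▸ Or.inl rfl)

theorem IsSeparatingContour.qPochInf_mul_ne_zero (hq : ‖q‖ < 1)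
    (h : IsSeparatingContour γ₁ (innerPoles q c) (outerPoles q b)) {z : ℂ} (hz : z ∈ range γ₁)
    (j : Fin 4) : qPochInf (b j * z) q ≠ 0 := by
  obtain ⟨t, rfl⟩ := hz
  exact qPochInf_ne_zero hq fun n hn => h.avoids_outside t ⟨j, n, hn⟩

theorem IsSeparatingContour.qPochInf_div_ne_zero (hq : ‖q‖ < 1)
    (h : IsSeparatingContour γ₁ (innerPoles q c) (outerPoles q b)) {z : ℂ} (hz : z ∈ range γ₁)
    (j : Fin 4) : qPochInf (c j / z) q ≠ 0 := by
  have hz0 := h.ne_zero hz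
  obtain ⟨t, rfl⟩ := hz
  refine qPochInf_ne_zero hq fun n hn => h.avoids_inside t (Or.inr ⟨j, n, ?_⟩)
  field_simp at hn
  exact hn.symm

/-- The integral of a function with poles in `innerPoles` and `outerPoles` is the same along all
contours separating these sets. -/
theorem lineIntegral_eq_of_isSeparatingContour (hq : ‖q‖ < 1)
    (h₁ : IsSeparatingContour γ₁ (innerPoles q c) (outerPoles q b))
    (h₂ : IsSeparatingContour γ₂ (innerPoles q c) (outerPoles q b)) {N : ℂ → ℂ}
    (hN : ∀ z ≠ 0, DifferentiableAt ℂ N z) :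
    lineIntegral (fun z => N z / ∏ j, (qPochInf (b j * z) q * qPochInf (c j / z) q)) γ₁ =
      lineIntegral (fun z => N z / ∏ j, (qPochInf (b j * z) q * qPochInf (c j / z) q)) γ₂ := by
  obtain ⟨r₁, R₁, hr₁, hb₁⟩ := exists_norm_bounds_of_zero_notMem γ₁ fun h => h₁.ne_zero h rfl
  obtain ⟨r₂, R₂, hr₂, hb₂⟩ := exists_norm_bounds_of_zero_notMem γ₂ fun h => h₂.ne_zero h rfl
  set r := min r₁ r₂ with hr
  set R := max R₁ R₂ with hR
  have hr0 : 0 < r := lt_min hr₁ hr₂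
  have hb₁' : ∀ z ∈ range γ₁, r < ‖z‖ ∧ ‖z‖ < R := fun z hz =>
    ⟨(min_le_left _ _).trans_lt (hb₁ z hz).1, (hb₁ z hz).2.trans_le (le_max_left _ _)⟩
  have hb₂' : ∀ z ∈ range γ₂, r < ‖z‖ ∧ ‖z‖ < R := fun z hz =>
    ⟨(min_le_right _ _).trans_lt (hb₂ z hz).1, (hb₂ z hz).2.trans_le (le_max_right _ _)⟩
  -- Beyond the first `K` factors, every factor of the denominator is nonzero on the whole annulus,
  -- so only finitely many poles matter.
  obtain ⟨K, hK⟩ : ∃ K : ℕ, ∀ j, ‖b j‖ * ‖q‖ ^ K * R < 1 ∧ ‖c j‖ * ‖q‖ ^ K / r < 1 := by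
    have h0 := tendsto_pow_atTop_nhds_zero_of_lt_one (norm_nonneg q) hq
    have : ∀ᶠ K in Filter.atTop, ∀ j : Fin 4,
        ‖b j‖ * ‖q‖ ^ K * R < 1 ∧ ‖c j‖ * ‖q‖ ^ K / r < 1 := by
      rw [Filter.eventually_all]
      intro j
      refine Filter.Eventually.and ?_ ?_
      · exact ((h0.const_mul ‖b j‖).mul_const R).eventually_lt_const (by simp)
      · exact ((h0.const_mul ‖c j‖).div_const r).eventually_lt_const (by simp)
    exact this.exists
  -- The power `z ^ (4 * K)` comes from clearing `z` in the `4 K` factors `1 - c_j q ^ i / z`.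
  set h : ℂ → ℂ := fun z => N z * z ^ (4 * K) /
    ∏ j, (qPochInf (b j * z * q ^ K) q * qPochInf (c j / z * q ^ K) q) with hh
  have hdiff : ∀ z : ℂ, r ≤ ‖z‖ → ‖z‖ ≤ R → DifferentiableAt ℂ h z := by
    intro z hz1 hz2
    have hzpos : 0 < ‖z‖ := hr0.trans_le hz1
    have hz0 : z ≠ 0 := norm_pos_iff.1 hzpos
    refine ((hN z hz0).mul (by fun_prop)).fun_div ?_ ?_
    · refine DifferentiableAt.fun_finsetProd fun j _ => DifferentiableAt.fun_mul ?_ ?_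
      · exact (differentiable_qPochInf hq _).fun_comp' z (by fun_prop)
      · exact (differentiable_qPochInf hq _).fun_comp' z (by fun_prop (disch := assumption))
    · refine Finset.prod_ne_zero_iff.2 fun j _ => mul_ne_zero ?_ ?_ <;>
        apply qPochInf_ne_zero_of_norm_lt_one hq
      · refine lt_of_le_of_lt ?_ (hK j).1
        rw [norm_mul, norm_mul, norm_pow, mul_right_comm]
        gcongr
      · refine lt_of_le_of_lt ?_ (hK j).2
        rw [norm_mul, norm_div, norm_pow, div_mul_eq_mul_div]
        gcongr
  obtain ⟨C, s, hs, e⟩ := exists_prod_linear_inv_eq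
    (Finset.univ ×ˢ Finset.range K : Finset (Fin 4 × ℕ)) (fun _ => 1)
    (fun x => -(b x.1 * q ^ x.2))
  obtain ⟨C', s', hs', e'⟩ := exists_prod_linear_inv_eq
    (Finset.univ ×ˢ Finset.range K : Finset (Fin 4 × ℕ)) (fun x => -(c x.1 * q ^ x.2))
    (fun _ => 1)
  have key : ∀ z ≠ 0, N z / ∏ j, (qPochInf (b j * z) q * qPochInf (c j / z) q) =
      C * C' * (h z * ((s + s').map fun w => (z - w)⁻¹).prod) := by
    intro z hz
    rw [Multiset.map_add, Multiset.prod_add]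
    have e2 : ∏ j, (qPochInf (b j * z) q * qPochInf (c j / z) q) =
        (∏ j, (qPochInf (b j * z * q ^ K) q * qPochInf (c j / z * q ^ K) q)) *
          (z ^ (4 * K))⁻¹ *
          (∏ x ∈ (Finset.univ ×ˢ Finset.range K : Finset (Fin 4 × ℕ)),
            (1 + -(b x.1 * q ^ x.2) * z)) *
          (∏ x ∈ (Finset.univ ×ˢ Finset.range K : Finset (Fin 4 × ℕ)),
            (-(c x.1 * q ^ x.2) + 1 * z)) := by
      have e3 : (z ^ (4 * K))⁻¹ = ∏ _j : Fin 4, (z ^ K)⁻¹ := by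
        rw [Finset.prod_const, Finset.card_univ, Fintype.card_fin, inv_pow, ← pow_mul, mul_comm K]
      rw [e3, Finset.prod_product, Finset.prod_product, ← Finset.prod_mul_distrib,
        ← Finset.prod_mul_distrib, ← Finset.prod_mul_distrib]
      refine Finset.prod_congr rfl fun j _ => ?_
      rw [qPochInf_eq_prod_mul hq (b j * z) K, qPochInf_eq_prod_mul hq (c j / z) K]
      have e4 : ∏ i ∈ Finset.range K, (1 - c j / z * q ^ i) =
          (z ^ K)⁻¹ * ∏ i ∈ Finset.range K, (-(c j * q ^ i) + 1 * z) := by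
        rw [← inv_pow, ← Finset.card_range K, ← Finset.prod_const, Finset.card_range,
          ← Finset.prod_mul_distrib]
        refine Finset.prod_congr rfl fun i _ => ?_
        field_simp
        ring
      have e5 : ∏ i ∈ Finset.range K, (1 - b j * z * q ^ i) =
          ∏ i ∈ Finset.range K, (1 + -(b j * q ^ i) * z) :=
        Finset.prod_congr rfl fun i _ => by ring
      rw [e4, e5]
      ring
    rw [e2, hh, div_eq_mul_inv, mul_inv, mul_inv, mul_inv, e z, e' z, inv_inv]
    ring
  have hw : ∀ w ∈ s + s', w ∈ innerPoles q c ∨ w ∈ outerPoles q b := by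
    intro w hw
    rcases Multiset.mem_add.1 hw with hw | hw
    · obtain ⟨x, hx⟩ := hs w hw
      exact Or.inr ⟨x.1, x.2, by linear_combination -hx⟩
    · obtain ⟨x, hx⟩ := hs' w hw
      exact Or.inl (Or.inr ⟨x.1, x.2, by linear_combination hx⟩)
  rw [lineIntegral_congr fun z hz => key z (h₁.ne_zero hz),
    lineIntegral_congr (γ := γ₂) fun z hz => key z (h₂.ne_zero hz), lineIntegral_const_mul,
    lineIntegral_const_mul]
  congr 1
  have h0 : (0 : ℂ) ∈ innerPoles q c := Or.inl rfl
  refine lineIntegral_mul_prod_sub_inv_eq h₁.piecewiseC1Path h₂.piecewiseC1Path hr0 hb₁' hb₂' hdiff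
    (lineIntegral_sub_inv_eq_of_windingNumber_eq
      ((h₁.winding_inside 0 h0).trans (h₂.winding_inside 0 h0).symm)) fun w hws => ?_
  rcases hw w hws with hw | hw
  · refine ⟨?_, ?_, lineIntegral_sub_inv_eq_of_windingNumber_eq
      ((h₁.winding_inside w hw).trans (h₂.winding_inside w hw).symm)⟩
    · rintro ⟨t, rfl⟩
      exact h₁.avoids_inside t hw
    · rintro ⟨t, rfl⟩
      exact h₂.avoids_inside t hw
  · refine ⟨?_, ?_, lineIntegral_sub_inv_eq_of_windingNumber_eq
      ((h₁.winding_outside w hw).trans (h₂.winding_outside w hw).symm)⟩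
    · rintro ⟨t, rfl⟩
      exact h₁.avoids_outside t hw
    · rintro ⟨t, rfl⟩
      exact h₂.avoids_outside t hw

end SeparatingContours

/-! ### Existence of separating contours. -/

section ContourExistence

open MeasureTheory Set

variable {q : ℂ} {b : Fin 4 → ℂ} {p v w : ℂ}

/-- The circle `t ↦ v exp (2 π i t)`. -/
noncomputable def circleLoop (v : ℂ) : Path v v where
  toFun t := v * Complex.exp (2 * Real.pi * Complex.I * (t : ℝ))
  continuous_toFun := by fun_prop
  source' := by simp
  target' := by simp [Complex.exp_two_pi_mul_I]

theorem circleLoop_extend {t : ℝ} (ht : t ∈ Icc (0 : ℝ) 1) :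
    (circleLoop v).extend t = v * Complex.exp (2 * Real.pi * Complex.I * t) := by
  rw [Path.extend_apply _ ht]
  rfl

theorem norm_eq_of_mem_range_circleLoop {z : ℂ} (hz : z ∈ range (circleLoop v)) : ‖z‖ = ‖v‖ := by
  obtain ⟨t, rfl⟩ := hz
  change ‖v * Complex.exp (2 * Real.pi * Complex.I * (t : ℝ))‖ = ‖v‖
  rw [norm_mul, show (2 * Real.pi * Complex.I * (t : ℝ) : ℂ) =
    ((2 * Real.pi * (t : ℝ) : ℝ) : ℂ) * Complex.I by push_cast; ring, Complex.norm_exp_ofReal_mul_I,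
    mul_one]

theorem piecewiseC1Path_circleLoop (v : ℂ) : PiecewiseC1Path (circleLoop v) := by
  refine piecewiseC1Path_of_contDiffOn ?_
  have h : ContDiffOn ℝ 1 (fun t : ℝ => v * Complex.exp (2 * Real.pi * Complex.I * t))
      (Icc 0 1) := by
    have : ContDiff ℝ 1 fun t : ℝ => (t : ℂ) := Complex.ofRealCLM.contDiff
    fun_prop
  exact h.congr fun t ht => circleLoop_extend ht

theorem lineIntegral_inv_circleLoop (hv : v ≠ 0) :
    lineIntegral (fun z => (z - 0)⁻¹) (circleLoop v) = 2 * Real.pi * Complex.I := by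
  rw [lineIntegral_eq, intervalIntegral.integral_congr_ae_restrict
    (g := fun _ => 2 * Real.pi * Complex.I)]
  · simp
  rw [uIoc_of_le zero_le_one, ← restrict_Ioo_eq_restrict_Ioc]
  filter_upwards [ae_restrict_mem measurableSet_Ioo] with t ht
  have he : (circleLoop v).extend =ᶠ[nhds t]
      fun t => v * Complex.exp (2 * Real.pi * Complex.I * t) := by
    filter_upwards [Icc_mem_nhds ht.1 ht.2] with s hs using circleLoop_extend hs
  have hd : HasDerivAt (fun t : ℝ => v * Complex.exp (2 * Real.pi * Complex.I * t))
      (v * (Complex.exp (2 * Real.pi * Complex.I * t) * (2 * Real.pi * Complex.I))) t := by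
    have h1 : HasDerivAt (fun t : ℝ => (t : ℂ)) 1 t := Complex.ofRealCLM.hasDerivAt
    simpa using ((h1.const_mul (2 * Real.pi * Complex.I)).cexp).const_mul v
  rw [he.deriv_eq, hd.deriv, circleLoop_extend (Ioo_subset_Icc_self ht), sub_zero]
  field_simp [Complex.exp_ne_zero]

theorem windingNumber_circleLoop_of_norm_lt (hw : ‖w‖ < ‖v‖) :
    windingNumber (circleLoop v) w = 1 := by
  have hv : v ≠ 0 := norm_pos_iff.1 ((norm_nonneg w).trans_lt hw)
  rw [windingNumber_eq, lineIntegral_sub_inv_eq_of_lt_norm (piecewiseC1Path_circleLoop v)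
    fun z hz => by rwa [norm_eq_of_mem_range_circleLoop hz], lineIntegral_inv_circleLoop hv,
    inv_mul_cancel₀ Complex.two_pi_I_ne_zero]

theorem windingNumber_circleLoop_of_lt_norm (hw : ‖v‖ < ‖w‖) :
    windingNumber (circleLoop v) w = 0 := by
  rw [windingNumber_eq, lineIntegral_sub_inv_eq_zero_of_norm_lt (piecewiseC1Path_circleLoop v)
    fun z hz => by rwa [norm_eq_of_mem_range_circleLoop hz], mul_zero]

/-- The translate of a path. -/
noncomputable def Path.addRight {a b : ℂ} (γ : Path a b) (c : ℂ) : Path (a + c) (b + c) :=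
  γ.map (continuous_add_const c)

theorem Path.extend_addRight {a b : ℂ} (γ : Path a b) (c : ℂ) :
    (γ.addRight c).extend = fun t => γ.extend t + c := by
  ext t
  rfl

theorem PiecewiseC1Path.addRight {a b : ℂ} {γ : Path a b} (hγ : PiecewiseC1Path γ) (c : ℂ) :
    PiecewiseC1Path (γ.addRight c) := by
  obtain ⟨P, hP⟩ := hγ
  refine ⟨P, fun u v hu huv hv h => ?_⟩
  rw [Path.extend_addRight]
  exact (hP u v hu huv hv h).add contDiffOn_const

theorem windingNumber_addRight (γ : Path p p) (c w : ℂ) :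
    windingNumber (γ.addRight c) w = windingNumber γ (w - c) := by
  simp only [windingNumber_eq, lineIntegral_eq, Path.extend_addRight, deriv_add_const]
  congr 2 with t
  ring

theorem windingNumber_trans {γ₁ γ₂ : Path p p} (h₁ : PiecewiseC1Path γ₁) (h₂ : PiecewiseC1Path γ₂)
    (hw₁ : w ∉ range γ₁) (hw₂ : w ∉ range γ₂) :
    windingNumber (γ₁.trans γ₂) w = windingNumber γ₁ w + windingNumber γ₂ w := by
  simp only [windingNumber_eq]
  rw [lineIntegral_trans h₁ h₂ (continuousOn_sub_inv hw₁) (continuousOn_sub_inv hw₂), mul_add]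

/-- A loop that winds once around an isolated point `w` of a countable set, and does not wind around
the other points of this set. -/
theorem exists_loop_around {N : Set ℂ} (hN : N.Countable) (hp : p ∉ N) (hw : w ∈ N)
    (hiso : ∀ᶠ x in nhds w, x ∈ N → x = w) :
    ∃ γ : Path p p, PiecewiseC1Path γ ∧ (∀ x ∈ N, x ∉ range γ) ∧ windingNumber γ w = 1 ∧
      ∀ x ∈ N, x ≠ w → windingNumber γ x = 0 := by
  have hwp : w - p ≠ 0 := sub_ne_zero.2 fun h => hp (h ▸ hw)
  obtain ⟨ε₀, hε₀, hball⟩ := Metric.eventually_nhds_iff.1 hiso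
  have hpos : 0 < ‖w - p‖ := norm_pos_iff.2 hwp
  -- The approach segment has direction `(w - p) (1 + i ε)`. A point `x` on it, other than `p`,
  -- determines `ε` as the slope of `(x - p) / (w - p)`, so all but countably many `ε` avoid `N`.
  obtain ⟨ε, hεN, hε⟩ := ((hN.image fun x => ((x - p) / (w - p)).im /
    ((x - p) / (w - p)).re).dense_compl ℝ).exists_mem_open
    (isOpen_Ioo (a := 0) (b := ε₀ / ‖w - p‖)) (nonempty_Ioo.2 (by positivity))
  set v : ℂ := ε * Complex.I * (w - p) with hv
  have hnv : ‖v‖ = ε * ‖w - p‖ := by simp [hv, abs_of_pos hε.1]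
  have hv0 : 0 < ‖v‖ := hnv ▸ mul_pos hε.1 hpos
  have hvε : ‖v‖ < ε₀ := by
    rw [hnv]
    exact (lt_div_iff₀ hpos).1 hε.2
  set α := Path.segment p (v + w)
  set δ := (circleLoop v).addRight w
  have hα : PiecewiseC1Path α := piecewiseC1Path_segment _ _
  have hδ : PiecewiseC1Path δ := (piecewiseC1Path_circleLoop v).addRight w
  have hrδ : ∀ x ∈ range δ, ‖x - w‖ = ‖v‖ := by
    rintro x ⟨t, rfl⟩
    rw [← norm_eq_of_mem_range_circleLoop (mem_range_self (f := circleLoop v) t)]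
    congr 1
    change circleLoop v t + w - w = _
    ring
  have hδN : ∀ x ∈ N, x ∉ range δ := by
    intro x hx hxr
    have h := hrδ x hxr
    have hxw := hball (by rw [Complex.dist_eq, h]; exact hvε) hx
    rw [hxw, sub_self, norm_zero] at h
    exact hv0.ne h
  have hαN : ∀ x ∈ N, x ∉ range α := by
    rintro x hx ⟨t, rfl⟩
    have e : α t = p + (t : ℝ) * (v + w - p) := by
      simp [α, AffineMap.lineMap_apply]
      ring
    refine hεN ⟨α t, hx, ?_⟩
    have ht : (t : ℝ) ≠ 0 := by
      intro ht
      rw [ht] at e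
      exact hp (by simpa [e] using hx)
    have e2 : (α t - p) / (w - p) = (t : ℝ) * (1 + ε * Complex.I) := by
      rw [e, hv, div_eq_iff hwp]
      ring
    simp only [e2]
    simp [ht]
  -- Out along the segment, once around the small circle, back along the segment: the two passages
  -- cancel.
  have hβ := (hα.trans hδ).trans hα.symm
  have hrange : ∀ x ∈ N, x ∉ range ((α.trans δ).trans α.symm) := by
    intro x hx
    rw [Path.trans_range, Path.trans_range, Path.symm_range]
    rintro ((h | h) | h)
    exacts [hαN x hx h, hδN x hx h, hαN x hx h]
  have hwind : ∀ x ∈ N, windingNumber ((α.trans δ).trans α.symm) x =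
      windingNumber (circleLoop v) (x - w) := by
    intro x hx
    rw [← windingNumber_addRight, windingNumber_eq, windingNumber_eq]
    have hc1 := continuousOn_sub_inv (hαN x hx)
    have hc2 := continuousOn_sub_inv (hδN x hx)
    have hc3 : ContinuousOn (fun z : ℂ => (z - x)⁻¹) (range α.symm) := by
      rwa [Path.symm_range]
    have hc4 : ContinuousOn (fun z : ℂ => (z - x)⁻¹) (range (α.trans δ)) := by
      refine continuousOn_sub_inv ?_
      rw [Path.trans_range]
      rintro (h | h)
      exacts [hαN x hx h, hδN x hx h]
    rw [lineIntegral_trans (hα.trans hδ) hα.symm hc4 hc3, lineIntegral_trans hα hδ hc1 hc2,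
      lineIntegral_symm]
    ring
  refine ⟨_, hβ, hrange, ?_, fun x hx hxw => ?_⟩
  · rw [hwind w hw]
    exact windingNumber_circleLoop_of_norm_lt (by simpa using hv0)
  · rw [hwind x hx]
    refine windingNumber_circleLoop_of_lt_norm ?_
    by_contra hle
    exact hxw (hball (by rw [Complex.dist_eq]; exact (not_lt.1 hle).trans_lt hvε) hx)

theorem exists_loop_around_finset {N : Set ℂ} (hN : N.Countable) (hp : p ∉ N) {γ₀ : Path p p}
    (h₀ : PiecewiseC1Path γ₀) (hγ₀ : ∀ x ∈ N, x ∉ range γ₀) (A : Finset ℂ)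
    (hA : ∀ w ∈ A, w ∈ N ∧ ∀ᶠ x in nhds w, x ∈ N → x = w) :
    ∃ γ : Path p p, PiecewiseC1Path γ ∧ (∀ x ∈ N, x ∉ range γ) ∧
      (∀ x ∈ N, x ∈ A → windingNumber γ x = windingNumber γ₀ x + 1) ∧
      ∀ x ∈ N, x ∉ A → windingNumber γ x = windingNumber γ₀ x := by
  induction A using Finset.induction with
  | empty => exact ⟨γ₀, h₀, hγ₀, by simp, by simp⟩
  | insert w A hwA ih =>
    obtain ⟨γ, hγ, hγN, h1, h2⟩ := ih fun w hw => hA w (Finset.mem_insert_of_mem hw)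
    obtain ⟨δ, hδ, hδN, h3, h4⟩ := exists_loop_around hN hp (hA w (by simp)).1 (hA w (by simp)).2
    refine ⟨γ.trans δ, hγ.trans hδ, fun x hx => ?_, fun x hx hxA => ?_, fun x hx hxA => ?_⟩
    · rw [Path.trans_range]
      rintro (h | h)
      exacts [hγN x hx h, hδN x hx h]
    · rw [windingNumber_trans hγ hδ (hγN x hx) (hδN x hx)]
      by_cases hxw : x = w
      · subst hxw
        rw [h2 x hx hwA, h3]
      · rw [h1 x hx ((Finset.mem_insert.1 hxA).resolve_left hxw), h4 x hx hxw, add_zero]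
    · rw [windingNumber_trans hγ hδ (hγN x hx) (hδN x hx)]
      rw [Finset.mem_insert, not_or] at hxA
      rw [h2 x hx hxA.2, h4 x hx hxA.1, add_zero]

theorem countable_innerPoles (q : ℂ) (b : Fin 4 → ℂ) : (innerPoles q b).Countable := by
  refine ((countable_singleton (0 : ℂ)).union
    (countable_range fun x : Fin 4 × ℕ => b x.1 * q ^ x.2)).mono ?_
  rintro z (rfl | ⟨j, k, rfl⟩)
  · exact Or.inl rfl
  · exact Or.inr ⟨(j, k), rfl⟩

theorem outerPoles_subset (q : ℂ) (b : Fin 4 → ℂ) :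
    outerPoles q b ⊆ (·⁻¹) '' innerPoles q b := by
  rintro z ⟨j, k, h⟩
  refine ⟨b j * q ^ k, Or.inr ⟨j, k, rfl⟩, ?_⟩
  exact inv_eq_iff_eq_inv.2 (eq_inv_of_mul_eq_one_left (by linear_combination h))

theorem finite_innerPoles_norm_ge (hq : ‖q‖ < 1) (b : Fin 4 → ℂ) {δ : ℝ} (hδ : 0 < δ) :
    (innerPoles q b ∩ {z | δ ≤ ‖z‖}).Finite := by
  obtain ⟨K, hK⟩ : ∃ K : ℕ, ∀ j, ‖b j‖ * ‖q‖ ^ K < δ := by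
    have h0 := tendsto_pow_atTop_nhds_zero_of_lt_one (norm_nonneg q) hq
    have : ∀ᶠ K in Filter.atTop, ∀ j : Fin 4, ‖b j‖ * ‖q‖ ^ K < δ :=
      Filter.eventually_all.2 fun j => (h0.const_mul ‖b j‖).eventually_lt_const (by simpa)
    exact this.exists
  refine (((Finset.univ ×ˢ Finset.range K : Finset (Fin 4 × ℕ)).image
    fun x => b x.1 * q ^ x.2).finite_toSet).subset ?_
  rintro z ⟨rfl | ⟨j, k, rfl⟩, hz⟩
  · simp only [mem_ofPred_eq, norm_zero] at hz
    linarith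
  · simp only [Finset.coe_image, mem_image, Finset.mem_coe, Finset.mem_product, Finset.mem_univ,
      true_and, Finset.mem_range]
    refine ⟨(j, k), ?_, rfl⟩
    by_contra hk
    simp only [mem_ofPred_eq, norm_mul, norm_pow] at hz
    have : ‖q‖ ^ k ≤ ‖q‖ ^ K := pow_le_pow_of_le_one (norm_nonneg q) hq.le (not_lt.1 hk)
    have := mul_le_mul_of_nonneg_left this (norm_nonneg (b j))
    linarith [hK j]

theorem finite_outerPoles_norm_le (hq : ‖q‖ < 1) (b : Fin 4 → ℂ) {R : ℝ} (hR : 0 < R) :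
    (outerPoles q b ∩ {z | ‖z‖ ≤ R}).Finite := by
  refine ((finite_innerPoles_norm_ge hq b (inv_pos.2 hR)).image (·⁻¹)).subset ?_
  rintro z ⟨hz, hzR⟩
  have hz0 : z ≠ 0 := by
    rintro rfl
    obtain ⟨j, k, h⟩ := hz
    simp at h
  obtain ⟨y, hy, rfl⟩ := outerPoles_subset q b hz
  refine ⟨y, ⟨hy, ?_⟩, rfl⟩
  simp only [mem_ofPred_eq, norm_inv] at hzR ⊢
  exact inv_le_of_inv_le₀ (norm_pos_iff.2 (by simpa using hz0)) hzR

/-- Start with a circle around `0` that has all outer poles outside and meets no pole. It misses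
only finitely many inner poles, each nonzero and hence isolated, and a loop is appended for each. By
`hb`, including `j = k`, no inner pole is an outer one. -/
theorem exists_isSeparatingContour_innerPoles (hq : ‖q‖ < 1)
    (hb : ∀ (j k : Fin 4) (n : ℕ), b j * b k * q ^ n ≠ 1) :
    ∃ (p : ℂ) (γ : Path p p), IsSeparatingContour γ (innerPoles q b) (outerPoles q b) := by
  set N := innerPoles q b ∪ outerPoles q b
  have hN : N.Countable := (countable_innerPoles q b).union
    (((countable_innerPoles q b).image _).mono (outerPoles_subset q b))
  have hdisj : ∀ z ∈ innerPoles q b, z ∉ outerPoles q b := by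
    rintro z (rfl | ⟨j, k, rfl⟩) ⟨i, l, h⟩
    · simp at h
    · exact hb i j (k + l) (by rw [pow_add]; linear_combination h)
  have hB : 0 < 1 + ∑ j, ‖b j‖ := by positivity
  -- Outer poles satisfy `|z| ≥ 1 / |b_j|`, which exceeds this upper bound for `r`; the countably
  -- many moduli of poles are avoided as well.
  obtain ⟨r, hrN, hr⟩ := ((hN.image (‖·‖)).dense_compl ℝ).exists_mem_open
    (isOpen_Ioo (a := 0) (b := (1 + ∑ j, ‖b j‖)⁻¹)) (nonempty_Ioo.2 (by positivity))
  have hr0 : 0 < r := hr.1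
  have hnr : ‖(r : ℂ)‖ = r := by simp [abs_of_pos hr0]
  have hout : ∀ z ∈ outerPoles q b, r < ‖z‖ := by
    rintro z ⟨j, k, h⟩
    by_contra hle
    have h1 : ‖b j * z * q ^ k‖ ≤ (∑ j, ‖b j‖) * r * 1 := by
      rw [norm_mul, norm_mul, norm_pow]
      gcongr
      · exact Finset.single_le_sum (f := fun j => ‖b j‖) (fun _ _ => norm_nonneg _)
          (Finset.mem_univ j)
      · exact not_lt.1 hle
      · exact pow_le_one₀ (norm_nonneg q) hq.le
    have h2 : r * (1 + ∑ j, ‖b j‖) < 1 := by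
      have := hr.2
      rwa [← one_div, lt_div_iff₀ hB] at this
    rw [h, norm_one] at h1
    nlinarith
  set A := (finite_innerPoles_norm_ge hq b hr0).toFinset
  have hA : ∀ w ∈ A, w ∈ N ∧ ∀ᶠ x in nhds w, x ∈ N → x = w := by
    intro w hw
    obtain ⟨hwS, hwr⟩ := (Finite.mem_toFinset _).1 hw
    have hw0 : 0 < ‖w‖ := hr0.trans_le hwr
    refine ⟨Or.inl hwS, ?_⟩
    have hfin := ((finite_innerPoles_norm_ge hq b (half_pos hw0)).union
      (finite_outerPoles_norm_le hq b (R := 2 * ‖w‖) (by positivity))).sdiff (t := {w})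
    have h1 := hfin.isClosed.isOpen_compl.mem_nhds (x := w) (by simp)
    have h2 : ∀ᶠ x in nhds w, ‖w‖ / 2 < ‖x‖ :=
      continuous_norm.continuousAt.eventually_const_lt (half_lt_self hw0)
    have h3 : ∀ᶠ x in nhds w, ‖x‖ < 2 * ‖w‖ :=
      continuous_norm.continuousAt.eventually_lt_const (by linarith)
    filter_upwards [h1, h2, h3] with x hx1 hx2 hx3 hxN
    by_contra hxw
    exact hx1 ⟨hxN.imp (fun h => ⟨h, hx2.le⟩) fun h => ⟨h, hx3.le⟩, hxw⟩
  obtain ⟨γ, hγ, hγN, h1, h2⟩ := exists_loop_around_finset (p := (r : ℂ)) hN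
    (fun h => hrN ⟨r, h, hnr⟩) (piecewiseC1Path_circleLoop r)
    (fun x hx hxr => hrN ⟨x, hx, (norm_eq_of_mem_range_circleLoop hxr).trans hnr⟩) A hA
  refine ⟨r, γ, hγ, fun t ht => hγN _ (Or.inl ht) ⟨t, rfl⟩,
    fun t ht => hγN _ (Or.inr ht) ⟨t, rfl⟩, fun w hw => ?_, fun w hw => ?_⟩
  · by_cases hwr : r ≤ ‖w‖
    · have hlt : ‖(r : ℂ)‖ < ‖w‖ := by
        rw [hnr]
        exact lt_of_le_of_ne hwr fun h => hrN ⟨w, Or.inl hw, h.symm⟩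
      rw [h1 w (Or.inl hw) ((Finite.mem_toFinset _).2 ⟨hw, hwr⟩),
        windingNumber_circleLoop_of_lt_norm hlt, zero_add]
    · rw [h2 w (Or.inl hw) fun h => hwr ((Finite.mem_toFinset _).1 h).2,
        windingNumber_circleLoop_of_norm_lt (by rw [hnr]; exact not_le.1 hwr)]
  · rw [h2 w (Or.inr hw) fun h => hdisj w ((Finite.mem_toFinset _).1 h).1 hw,
      windingNumber_circleLoop_of_lt_norm (by rw [hnr]; exact hout w hw)]

/-- Scaling a separating contour. -/
theorem IsSeparatingContour.mulLeft {γ : Path p p} {S T S' T' : Set ℂ} {k : ℂ} (hk : k ≠ 0)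
    (h : IsSeparatingContour γ S T) (hS : ∀ z, k * z ∈ S' ↔ z ∈ S) (hT : ∀ z, k * z ∈ T' ↔ z ∈ T) :
    IsSeparatingContour (γ.mulLeft k) S' T' := by
  have hw : ∀ w, windingNumber (γ.mulLeft k) (k * w) = windingNumber γ w := by
    intro w
    simp only [windingNumber_eq, lineIntegral_mulLeft]
    congr 2 with z
    rw [← mul_sub, mul_inv, mul_inv_cancel_left₀ hk]
  have hk' : ∀ w, k * (k⁻¹ * w) = w := fun w => mul_inv_cancel_left₀ hk w
  refine ⟨h.piecewiseC1Path.mulLeft k, fun t ht => ?_, fun t ht => ?_, fun w hwS => ?_,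
    fun w hwT => ?_⟩
  · exact h.avoids_inside t ((hS _).1 ht)
  · exact h.avoids_outside t ((hT _).1 ht)
  · rw [← hk' w, hw]
    exact h.winding_inside _ ((hS _).1 (by rwa [hk']))
  · rw [← hk' w, hw]
    exact h.winding_outside _ ((hT _).1 (by rwa [hk']))

end ContourExistence

/-! ### The very-well-poised bilateral series: symmetries and convergence. -/

section BilateralSum

open Filter Topology

variable {q : ℂ} {c : Fin 4 → ℂ} {C : Fin 4 → ℝ} {x y : ℂ}

/-- The product `(e y, e / y; q)_∞`. -/
noncomputable def qPochPair (q e y : ℂ) : ℂ := qPochInf (e * y) q * qPochInf (e / y) q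

theorem qPochPair_zero (q y : ℂ) : qPochPair q 0 y = 1 := by
  simp [qPochPair, qPochInf_zero]

theorem qPochPair_inv (q e y : ℂ) : qPochPair q e y⁻¹ = qPochPair q e y := by
  rw [qPochPair, qPochPair, div_inv_eq_mul, ← div_eq_mul_inv, mul_comm]

theorem qPochPair_eq_mul (hq : ‖q‖ < 1) (e y : ℂ) :
    qPochPair q e y = (1 - e * y) * (1 - e / y) * qPochPair q (q * e) y := by
  rw [qPochPair, qPochPair, qPochInf_eq_one_sub_mul hq (e * y), qPochInf_eq_one_sub_mul hq (e / y)]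
  ring_nf

/-- Both sides are `(q e y, e / y; q)_∞`. The product form needs no nonvanishing. -/
theorem qPochPair_mul_left (hq : ‖q‖ < 1) (hq0 : q ≠ 0) (e : ℂ) (hy : y ≠ 0) :
    (1 - e * (q * y)) * qPochPair q (q * e) (q * y) = (1 - e / y) * qPochPair q (q * e) y := by
  have h1 := qPochInf_eq_one_sub_mul hq (e * (q * y))
  have h2 := qPochInf_eq_one_sub_mul hq (e / y)
  rw [qPochPair, qPochPair, show q * e / (q * y) = e / y by field_simp, h2,
    show q * e * (q * y) = e * (q * y) * q by ring, ← mul_assoc, ← h1]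
  ring_nf

theorem continuous_qPochPair (hq : ‖q‖ < 1) (y : ℂ) : Continuous fun e => qPochPair q e y :=
  ((continuous_qPochInf hq).comp (continuous_mul_const y)).mul
    ((continuous_qPochInf hq).comp (continuous_id.div_const y))

theorem differentiableAt_qPochPair (hq : ‖q‖ < 1) (e : ℂ) (hy : y ≠ 0) :
    DifferentiableAt ℂ (qPochPair q e) y := by
  refine DifferentiableAt.fun_mul ?_ ?_
  · exact (differentiable_qPochInf hq _).fun_comp' y (by fun_prop)
  · exact (differentiable_qPochInf hq _).fun_comp' y (by fun_prop (disch := assumption))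

theorem prod_one_add_pow_le {t s : ℝ} (ht0 : 0 ≤ t) (ht1 : t < 1) (hs : 0 ≤ s) (n : ℕ) :
    ∏ i ∈ Finset.range n, (1 + s * t ^ i) ≤ Real.exp (s * (1 - t)⁻¹) := by
  calc ∏ i ∈ Finset.range n, (1 + s * t ^ i) ≤ ∏ i ∈ Finset.range n, Real.exp (s * t ^ i) := by
        refine Finset.prod_le_prod (fun i _ => by positivity) fun i _ => ?_
        rw [add_comm]
        exact Real.add_one_le_exp _
    _ = Real.exp (s * ∑ i ∈ Finset.range n, t ^ i) := by
        rw [← Real.exp_sum, Finset.mul_sum]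
    _ ≤ _ := by
        gcongr
        rw [← tsum_geometric_of_lt_one ht0 ht1]
        exact (summable_geometric_of_lt_one ht0 ht1).sum_le_tsum _ fun i _ => by positivity

/-- Only `(q a / (q ^ n x); q)_∞` grows. It has `n` additional factors `1 - a / (q ^ i x)`, each of
size about `A / (|x| |q| ^ i)`, with relative errors whose product stays bounded. -/
theorem exists_norm_qPochPair_le (hq : ‖q‖ < 1) (hq0 : q ≠ 0) {A r : ℝ} (hA : 0 < A) (hr : 0 < r)
    (R : ℝ) : ∃ M : ℝ, 0 < M ∧ ∀ (n : ℕ) (a x : ℂ), ‖a‖ ≤ A → r ≤ ‖x‖ → ‖x‖ ≤ R →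
      ‖qPochPair q (q * a) (q ^ n * x)‖ ≤
        M * ((A / ‖x‖) ^ n * (∏ i ∈ Finset.range n, ‖q‖ ^ i)⁻¹) := by
  obtain ⟨B₁, hB₁, h₁⟩ := exists_norm_qPochInf_le hq (A * R)
  obtain ⟨B₂, hB₂, h₂⟩ := exists_norm_qPochInf_le hq (A / r)
  have hqpos : 0 < ‖q‖ := norm_pos_iff.2 hq0
  refine ⟨B₁ * (B₂ * Real.exp (R / A * (1 - ‖q‖)⁻¹)), by positivity, fun n a x ha hxr hxR => ?_⟩
  have hxpos : 0 < ‖x‖ := hr.trans_le hxr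
  have hx : x ≠ 0 := norm_pos_iff.1 hxpos
  have hR : 0 < R := hxpos.trans_le hxR
  have e1 : ‖qPochInf (q * a * (q ^ n * x)) q‖ ≤ B₁ := by
    refine h₁ _ ?_
    calc ‖q * a * (q ^ n * x)‖ = ‖q‖ ^ (n + 1) * (‖a‖ * ‖x‖) := by
          simp only [norm_mul, norm_pow]
          ring
      _ ≤ 1 * (A * R) := by
          gcongr
          exact pow_le_one₀ (norm_nonneg q) hq.le
      _ = A * R := one_mul _
  have e2 : ‖qPochInf (q * a / x) q‖ ≤ B₂ := by
    refine h₂ _ ?_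
    rw [norm_div, norm_mul]
    gcongr
    exact (mul_le_of_le_one_left (norm_nonneg a) hq.le).trans ha
  have e3 : qPochInf (q * a / (q ^ n * x)) q =
      (∏ i ∈ Finset.range n, (1 - a / (q ^ i * x))) * qPochInf (q * a / x) q := by
    rw [qPochInf_eq_prod_mul hq _ n]
    congr 1
    · rw [← Finset.prod_range_reflect]
      refine Finset.prod_congr rfl fun i hi => ?_
      have hi' : i < n := Finset.mem_range.1 hi
      obtain ⟨k, rfl⟩ : ∃ k, n = i + 1 + k := ⟨n - (i + 1), by omega⟩
      rw [show i + 1 + k - 1 - i = k by omega]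
      congr 1
      field_simp
      ring
    · congr 1
      field_simp
  have e4 : ‖∏ i ∈ Finset.range n, (1 - a / (q ^ i * x))‖ ≤
      Real.exp (R / A * (1 - ‖q‖)⁻¹) *
        ((A / ‖x‖) ^ n * (∏ i ∈ Finset.range n, ‖q‖ ^ i)⁻¹) := by
    rw [norm_prod]
    calc ∏ i ∈ Finset.range n, ‖1 - a / (q ^ i * x)‖
        ≤ ∏ i ∈ Finset.range n, ((1 + R / A * ‖q‖ ^ i) * (A / ‖x‖ * (‖q‖ ^ i)⁻¹)) := by
          refine Finset.prod_le_prod (fun _ _ => norm_nonneg _) fun i _ => ?_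
          calc ‖1 - a / (q ^ i * x)‖ ≤ 1 + ‖a‖ / (‖q‖ ^ i * ‖x‖) := by
                refine (norm_sub_le _ _).trans ?_
                simp
            -- Weakening `1` to `R / ‖x‖` lets the main size `A / (‖x‖ ‖q‖ ^ i)` factor out.
            _ ≤ R / ‖x‖ + A / (‖q‖ ^ i * ‖x‖) := by
                gcongr
                exact (one_le_div hxpos).2 hxR
            _ = (1 + R / A * ‖q‖ ^ i) * (A / ‖x‖ * (‖q‖ ^ i)⁻¹) := by
                field_simp
                ring
      _ = (∏ i ∈ Finset.range n, (1 + R / A * ‖q‖ ^ i)) *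
            ((A / ‖x‖) ^ n * (∏ i ∈ Finset.range n, ‖q‖ ^ i)⁻¹) := by
          rw [Finset.prod_mul_distrib, Finset.prod_mul_distrib, Finset.prod_const,
            Finset.card_range, Finset.prod_inv_distrib]
      _ ≤ _ := by
          gcongr
          exact prod_one_add_pow_le (norm_nonneg q) hq (by positivity) n
  rw [qPochPair, e3, norm_mul, norm_mul]
  calc _ ≤ B₁ * (Real.exp (R / A * (1 - ‖q‖)⁻¹) *
        ((A / ‖x‖) ^ n * (∏ i ∈ Finset.range n, ‖q‖ ^ i)⁻¹) * B₂) := by gcongr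
    _ = _ := by ring

/-- The common part of the terms of the very-well-poised bilateral series, apart from the factor
`1 - q ^ (2 m) x ^ 2`. -/
noncomputable def poisedCore (q : ℂ) (c : Fin 4 → ℂ) (m : ℤ) (x : ℂ) : ℂ :=
  (∏ j, qPochPair q (q * c j) (q ^ m * x)) * (q ^ (2 * m ^ 2 - m) * x ^ (4 * m))

/-- The terms of the very-well-poised bilateral series. -/
noncomputable def poisedTerm (q : ℂ) (c : Fin 4 → ℂ) (m : ℤ) (x : ℂ) : ℂ :=
  (1 - (q ^ m * x) ^ 2) * poisedCore q c m x

/-- The sequence whose differences give the contiguous relation for the bilateral series. -/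
noncomputable def poisedCert (q : ℂ) (c : Fin 4 → ℂ) (m : ℤ) (x : ℂ) : ℂ :=
  (∏ j, (1 - c j * (q ^ m * x))) * (q ^ m * x)⁻¹ * poisedCore q c m x

theorem prod_pow_range_pow_four {t : ℝ} (ht : t ≠ 0) (n : ℕ) :
    (∏ i ∈ Finset.range n, t ^ i) ^ 4 * t ^ n = t ^ (2 * (n : ℤ) ^ 2 - n) := by
  induction n with
  | zero => simp
  | succ n ih =>
    rw [Finset.prod_range_succ, show (2 * ((n + 1 : ℕ) : ℤ) ^ 2 - (n + 1 : ℕ)) =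
      (2 * (n : ℤ) ^ 2 - n) + ((4 * n + 1 : ℕ) : ℤ) by push_cast; ring, zpow_add₀ ht, ← ih,
      zpow_natCast]
    ring

/-- The four pairs grow like `|q| ^ (-2 n (n - 1)) |x| ^ (-4 n) (∏ C_j) ^ n`. The weight `q ^ (2 n ^
2 - n) x ^ (4 n)` cancels all but `(|q| ∏ C_j) ^ n`. For `C_j = 1 / |a_j|` this decays exactly when
`|q| < |a_1 a_2 a_3 a_4|`. -/
theorem exists_norm_poisedCore_le (hq : ‖q‖ < 1) (hq0 : q ≠ 0) (hC : ∀ j, 0 < C j) {r : ℝ}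
    (hr : 0 < r) (R : ℝ) : ∃ M : ℝ, 0 < M ∧ ∀ (n : ℕ) (c : Fin 4 → ℂ) (x : ℂ),
      (∀ j, ‖c j‖ ≤ C j) → r ≤ ‖x‖ → ‖x‖ ≤ R →
      ‖poisedCore q c n x‖ ≤ M * (‖q‖ * ∏ j, C j) ^ n := by
  choose M hM h using fun j => exists_norm_qPochPair_le hq hq0 (hC j) hr R
  refine ⟨∏ j, M j, Finset.prod_pos fun j _ => hM j, fun n c x hc hxr hxR => ?_⟩
  have hqpos : 0 < ‖q‖ := norm_pos_iff.2 hq0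
  have hxpos : 0 < ‖x‖ := hr.trans_le hxr
  have hE : 0 < ∏ i ∈ Finset.range n, ‖q‖ ^ i := Finset.prod_pos fun i _ => by positivity
  rw [poisedCore, norm_mul, norm_prod, norm_mul, norm_zpow, norm_zpow,
    ← prod_pow_range_pow_four hqpos.ne']
  calc _ ≤ (∏ j, (M j * ((C j / ‖x‖) ^ n * (∏ i ∈ Finset.range n, ‖q‖ ^ i)⁻¹))) *
        ((∏ i ∈ Finset.range n, ‖q‖ ^ i) ^ 4 * ‖q‖ ^ n * ‖x‖ ^ (4 * (n : ℤ))) := by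
        gcongr with j
        exact h j n (c j) x (hc j) hxr hxR
    _ = _ := by
        rw [Finset.prod_mul_distrib, Finset.prod_mul_distrib, Finset.prod_const, Finset.prod_pow,
          Finset.prod_div_distrib, Finset.prod_const, Finset.card_univ, Fintype.card_fin,
          show (4 * (n : ℤ)) = ((4 * n : ℕ) : ℤ) by push_cast; ring, zpow_natCast, mul_pow,
          div_pow, pow_mul]
        field_simp

/-- Each pair is invariant under `y ↦ 1 / y`; hence estimates for negative indices reduce to those
for positive indices at `x⁻¹`. -/
theorem poisedCore_neg (hq0 : q ≠ 0) (c : Fin 4 → ℂ) (m : ℤ) (x : ℂ) :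
    poisedCore q c (-m) x = (q ^ m) ^ 2 * poisedCore q c m x⁻¹ := by
  have h : q ^ (-m) * x = (q ^ m * x⁻¹)⁻¹ := by
    rw [mul_inv, inv_inv, zpow_neg]
  have h2 : q ^ (2 * (-m) ^ 2 - -m) = (q ^ m) ^ 2 * q ^ (2 * m ^ 2 - m) := by
    rw [← zpow_natCast, ← zpow_mul, ← zpow_add₀ hq0]
    congr 1
    push_cast
    ring
  simp only [poisedCore, h, qPochPair_inv, h2]
  rw [inv_zpow', show 4 * -m = -(4 * m) by ring]
  ring

theorem poisedTerm_neg (hq0 : q ≠ 0) (c : Fin 4 → ℂ) (m : ℤ) (hx : x ≠ 0) :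
    poisedTerm q c (-m) x = -x ^ 2 * poisedTerm q c m x⁻¹ := by
  have hqm : q ^ m ≠ 0 := zpow_ne_zero m hq0
  rw [poisedTerm, poisedTerm, poisedCore_neg hq0 c m x, zpow_neg]
  field_simp
  ring

theorem prod_qPochPair_mul_left (hq : ‖q‖ < 1) (hq0 : q ≠ 0) (c : Fin 4 → ℂ) (hy : y ≠ 0) :
    (∏ j, (1 - c j * (q * y))) * ∏ j, qPochPair q (q * c j) (q * y) =
      (∏ j, (1 - c j / y)) * ∏ j, qPochPair q (q * c j) y := by
  rw [← Finset.prod_mul_distrib, ← Finset.prod_mul_distrib]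
  exact Finset.prod_congr rfl fun j _ => qPochPair_mul_left hq hq0 (c j) hy

/-- By `prod_qPochPair_mul_left` the shifted sequence is again an elementary factor times the
unshifted core, so its differences become comparable with `poisedTerm`. -/
theorem poisedCert_add_one (hq : ‖q‖ < 1) (hq0 : q ≠ 0) (c : Fin 4 → ℂ) (m : ℤ) (hx : x ≠ 0) :
    poisedCert q c (m + 1) x =
      (∏ j, (1 - c j / (q ^ m * x))) * (q ^ m * x) ^ 3 * poisedCore q c m x := by
  have hqm : q ^ m ≠ 0 := zpow_ne_zero m hq0
  have hy : q ^ m * x ≠ 0 := mul_ne_zero hqm hx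
  have e1 : q ^ (m + 1) * x = q * (q ^ m * x) := by
    rw [zpow_add_one₀ hq0]
    ring
  have e2 : q ^ (2 * (m + 1) ^ 2 - (m + 1)) = q ^ (2 * m ^ 2 - m) * ((q ^ m) ^ 4 * q) := by
    rw [← zpow_natCast (q ^ m), ← zpow_mul, ← zpow_add_one₀ hq0, ← zpow_add₀ hq0]
    congr 1
    push_cast
    ring
  have e3 : x ^ (4 * (m + 1)) = x ^ (4 * m) * x ^ 4 := by
    rw [mul_add, mul_one, zpow_add₀ hx]
    rfl
  rw [poisedCert, poisedCore, e1, e2, e3, poisedCore]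
  have h := prod_qPochPair_mul_left hq hq0 c hy
  calc _ = ((∏ j, (1 - c j * (q * (q ^ m * x)))) *
        ∏ j, qPochPair q (q * c j) (q * (q ^ m * x))) * ((q * (q ^ m * x))⁻¹ *
        (q ^ (2 * m ^ 2 - m) * ((q ^ m) ^ 4 * q) * (x ^ (4 * m) * x ^ 4))) := by ring
    _ = _ := by
        rw [h]
        field_simp

theorem poisedCert_neg (hq : ‖q‖ < 1) (hq0 : q ≠ 0) (c : Fin 4 → ℂ) (m : ℤ) (hx : x ≠ 0) :
    poisedCert q c (-m) x = x ^ 2 * poisedCert q c (m + 1) x⁻¹ := by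
  have hqm : q ^ m ≠ 0 := zpow_ne_zero m hq0
  rw [poisedCert_add_one hq hq0 c m (inv_ne_zero hx), poisedCert, poisedCore_neg hq0 c m x]
  have e : ∀ j, 1 - c j * (q ^ (-m) * x) = 1 - c j / (q ^ m * x⁻¹) := fun j => by
    rw [zpow_neg]
    field_simp
  simp only [e]
  generalize ∏ j, (1 - c j / (q ^ m * x⁻¹)) = P
  rw [zpow_neg]
  field_simp

theorem summable_int_of_norm_le {f : ℤ → ℂ} {ρ M M' : ℝ} (hρ0 : 0 ≤ ρ) (hρ : ρ < 1)
    (h : ∀ n : ℕ, ‖f n‖ ≤ M * ρ ^ n) (h' : ∀ n : ℕ, ‖f (-n)‖ ≤ M' * ρ ^ n) : Summable f :=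
  .of_nat_of_neg
    (.of_norm_bounded ((summable_geometric_of_lt_one hρ0 hρ).mul_left M) h)
    (.of_norm_bounded ((summable_geometric_of_lt_one hρ0 hρ).mul_left M') h')

/-- A summable bound for the terms of the bilateral series, uniform in the parameters. -/
theorem exists_summable_norm_poisedTerm_le (hq : ‖q‖ < 1) (hq0 : q ≠ 0) (hC : ∀ j, 0 < C j)
    (hC1 : ‖q‖ * ∏ j, C j < 1) {r : ℝ} (hr : 0 < r) (R : ℝ) :
    ∃ u : ℤ → ℝ, Summable u ∧ ∀ (m : ℤ) (c : Fin 4 → ℂ) (x : ℂ), (∀ j, ‖c j‖ ≤ C j) →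
      r ≤ ‖x‖ → ‖x‖ ≤ R → ‖poisedTerm q c m x‖ ≤ u m := by
  have key : ∀ r R : ℝ, 0 < r → ∃ M : ℝ, 0 < M ∧ ∀ (n : ℕ) (c : Fin 4 → ℂ) (x : ℂ),
      (∀ j, ‖c j‖ ≤ C j) → r ≤ ‖x‖ → ‖x‖ ≤ R →
      ‖poisedTerm q c n x‖ ≤ M * (‖q‖ * ∏ j, C j) ^ n := by
    intro r R hr
    obtain ⟨M, hM, h⟩ := exists_norm_poisedCore_le hq hq0 hC hr R
    refine ⟨(1 + R ^ 2) * M, by positivity, fun n c x hc hxr hxR => ?_⟩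
    rw [poisedTerm, norm_mul, mul_assoc]
    gcongr
    · refine (norm_sub_le _ _).trans ?_
      rw [norm_one, norm_pow, norm_mul, zpow_natCast, norm_pow]
      gcongr
      exact (mul_le_of_le_one_left (norm_nonneg x) (pow_le_one₀ (norm_nonneg q) hq.le)).trans hxR
    · exact h n c x hc hxr hxR
  have hρ0 : 0 ≤ ‖q‖ * ∏ j, C j :=
    mul_nonneg (norm_nonneg q) (Finset.prod_nonneg fun j _ => (hC j).le)
  obtain ⟨M, hM, h⟩ := key r R hr
  -- Negative indices use `x⁻¹`, hence the inverted bounds. Since `R` is arbitrary, `max R r` keeps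
  -- the lower bound positive.
  obtain ⟨M', hM', h'⟩ := key (max R r)⁻¹ r⁻¹ (by positivity)
  refine ⟨fun m => (M + R ^ 2 * M') * (‖q‖ * ∏ j, C j) ^ m.natAbs, ?_, fun m c x hc hxr hxR => ?_⟩
  · refine Summable.mul_left _ (.of_nat_of_neg ?_ ?_) <;>
      simpa using summable_geometric_of_lt_one hρ0 hC1
  · have hxpos : 0 < ‖x‖ := hr.trans_le hxr
    have hx : x ≠ 0 := norm_pos_iff.1 hxpos
    rcases Int.natAbs_eq m with hm | hm <;> rw [hm] <;> simp only [Int.natAbs_neg, Int.natAbs_natCast]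
    · refine (h m.natAbs c x hc hxr hxR).trans ?_
      gcongr
      have : 0 ≤ R ^ 2 * M' := by positivity
      linarith
    · rw [poisedTerm_neg hq0 c _ hx, norm_mul, norm_neg, norm_pow]
      calc _ ≤ R ^ 2 * (M' * (‖q‖ * ∏ j, C j) ^ m.natAbs) := by
            gcongr
            refine h' m.natAbs c x⁻¹ hc ?_ ?_
            · rw [norm_inv]
              gcongr
              exact hxR.trans (le_max_left _ _)
            · rw [norm_inv]
              gcongr
        _ ≤ _ := by
            rw [← mul_assoc]
            gcongr
            linarith

theorem summable_poisedTerm (hq : ‖q‖ < 1) (hq0 : q ≠ 0) (hC : ∀ j, 0 < C j)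
    (hC1 : ‖q‖ * ∏ j, C j < 1) (hc : ∀ j, ‖c j‖ ≤ C j) (hx : x ≠ 0) :
    Summable fun m => poisedTerm q c m x := by
  obtain ⟨u, hu, h⟩ := exists_summable_norm_poisedTerm_le hq hq0 hC hC1 (norm_pos_iff.2 hx) ‖x‖
  exact .of_norm_bounded hu fun m => h m c x hc le_rfl le_rfl

/-- The factor `(q ^ m x)⁻¹` costs `|q| ^ (-n)`, so `∏ C_j < 1` replaces `|q| ∏ C_j < 1`. Applied to
the parameters `q a, b, c, d`, this is the original condition again. -/
theorem summable_poisedCert (hq : ‖q‖ < 1) (hq0 : q ≠ 0) (hC : ∀ j, 0 < C j)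
    (hC1 : ∏ j, C j < 1) (hc : ∀ j, ‖c j‖ ≤ C j) (hx : x ≠ 0) :
    Summable fun m => poisedCert q c m x := by
  have hqpos : 0 < ‖q‖ := norm_pos_iff.2 hq0
  have hρ0 : 0 < ∏ j, C j := Finset.prod_pos fun j _ => hC j
  have key : ∀ x : ℂ, x ≠ 0 → ∃ M : ℝ, ∀ n : ℕ,
      ‖poisedCert q c n x‖ ≤ M * (∏ j, C j) ^ n := by
    intro x hx
    have hxpos := norm_pos_iff.2 hx
    obtain ⟨M, hM, h⟩ := exists_norm_poisedCore_le hq hq0 hC hxpos ‖x‖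
    have hP : 0 ≤ ∏ j, (1 + C j * ‖x‖) :=
      Finset.prod_nonneg fun j _ => by have := hC j; positivity
    refine ⟨(∏ j, (1 + C j * ‖x‖)) * (‖x‖⁻¹ * M), fun n => ?_⟩
    rw [poisedCert, norm_mul, norm_mul, norm_prod, norm_inv, norm_mul, zpow_natCast, norm_pow]
    calc _ ≤ (∏ j, (1 + C j * ‖x‖)) * (‖q‖ ^ n * ‖x‖)⁻¹ * (M * (‖q‖ * ∏ j, C j) ^ n) := by
          gcongr with j
          · refine (norm_sub_le _ _).trans ?_
            rw [norm_one, norm_mul, norm_mul, norm_pow]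
            gcongr
            · exact (hC j).le
            · exact hc j
            · exact mul_le_of_le_one_left (norm_nonneg x) (pow_le_one₀ (norm_nonneg q) hq.le)
          · exact h n c x hc le_rfl le_rfl
      _ = _ := by
          generalize ∏ j, (1 + C j * ‖x‖) = P
          rw [mul_pow]
          field_simp
  obtain ⟨M, h⟩ := key x hx
  obtain ⟨M', h'⟩ := key x⁻¹ (inv_ne_zero hx)
  refine summable_int_of_norm_le hρ0.le hC1 (M' := ‖x‖ ^ 2 * (M' * ∏ j, C j)) h fun n => ?_
  rw [poisedCert_neg hq hq0 c n hx, norm_mul, norm_pow]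
  calc _ ≤ ‖x‖ ^ 2 * (M' * (∏ j, C j) ^ (n + 1)) := by
        gcongr
        exact_mod_cast h' (n + 1)
    _ = _ := by ring

end BilateralSum

/-! ### Bailey's sum by iterated contiguous relations. -/

section BilateralSummation

open Filter Topology

variable {q : ℂ} {x : ℂ} {a b c d : ℂ} {A B C D : ℝ}

/-- Iterate the recurrence and let `n → ∞`. It is kept in cross-multiplied form, so that `α n` and
`β n` may vanish. It serves both the series and the integral. -/
theorem mul_eq_mul_of_tendsto_of_recurrence {L α β : ℕ → ℂ} {ℓ α' β' : ℂ}
    (hα : Tendsto (fun n => ∏ i ∈ Finset.range n, α i) atTop (𝓝 α'))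
    (hβ : Tendsto (fun n => ∏ i ∈ Finset.range n, β i) atTop (𝓝 β'))
    (hL : Tendsto L atTop (𝓝 ℓ)) (h : ∀ n, α n * L n = β n * L (n + 1)) :
    α' * L 0 = β' * ℓ := by
  have key : ∀ n, (∏ i ∈ Finset.range n, α i) * L 0 = (∏ i ∈ Finset.range n, β i) * L n := by
    intro n
    induction n with
    | zero => simp
    | succ n ih =>
      rw [Finset.prod_range_succ, Finset.prod_range_succ]
      linear_combination α n * ih + (∏ i ∈ Finset.range n, β i) * h n
  refine tendsto_nhds_unique (hα.mul_const (L 0)) ?_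
  simp only [key]
  exact hβ.mul hL

theorem tendsto_prod_three_qPochInf (hq : ‖q‖ < 1) (u v w : ℂ) :
    Tendsto (fun n => ∏ i ∈ Finset.range n, ((1 - u * q ^ i) * (1 - v * q ^ i) * (1 - w * q ^ i)))
      atTop (𝓝 (qPochInf u q * qPochInf v q * qPochInf w q)) := by
  simp only [Finset.prod_mul_distrib]
  exact ((tendsto_prod_qPochInf hq u).mul (tendsto_prod_qPochInf hq v)).mul
    (tendsto_prod_qPochInf hq w)

theorem poisedTerm_rotate (q a b c d : ℂ) (m : ℤ) (x : ℂ) :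
    poisedTerm q ![a, b, c, d] m x = poisedTerm q ![b, c, d, a] m x := by
  simp only [poisedTerm, poisedCore, Fin.prod_univ_four, Matrix.cons_val]
  ring

/-- All terms share the core with parameters `q a, b, c, d`. After it is factored out, a rational
identity in `y = q ^ m x` remains. -/
theorem poisedTerm_contiguous (hq : ‖q‖ < 1) (hq0 : q ≠ 0) (hx : x ≠ 0) (m : ℤ) :
    (1 - q * a * b * c * d) * poisedTerm q ![a, b, c, d] m x =
      (1 - q * a * b) * (1 - q * a * c) * (1 - q * a * d) *
        poisedTerm q ![q * a, b, c, d] m x +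
      q * a * (poisedCert q ![q * a, b, c, d] (m + 1) x - poisedCert q ![q * a, b, c, d] m x) := by
  have hy : q ^ m * x ≠ 0 := mul_ne_zero (zpow_ne_zero m hq0) hx
  have e : poisedCore q ![a, b, c, d] m x = (1 - q * a * (q ^ m * x)) * (1 - q * a / (q ^ m * x)) *
      poisedCore q ![q * a, b, c, d] m x := by
    simp only [poisedCore, Fin.prod_univ_four]
    simp only [Matrix.cons_val]
    rw [qPochPair_eq_mul hq (q * a) (q ^ m * x)]
    ring
  rw [poisedCert_add_one hq hq0 _ m hx, poisedCert, poisedTerm, poisedTerm, e]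
  simp only [Fin.prod_univ_four, Matrix.cons_val]
  generalize poisedCore q ![q * a, b, c, d] m x = K
  generalize q ^ m * x = y at hy
  field_simp
  ring

theorem forall_norm_vec_le (ha : ‖a‖ ≤ A) (hb : ‖b‖ ≤ B) (hc : ‖c‖ ≤ C) (hd : ‖d‖ ≤ D) :
    ∀ j, ‖(![a, b, c, d] : Fin 4 → ℂ) j‖ ≤ (![A, B, C, D] : Fin 4 → ℝ) j := by
  intro j
  fin_cases j <;> simpa

theorem forall_vec_pos (hA : 0 < A) (hB : 0 < B) (hC : 0 < C) (hD : 0 < D) :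
    ∀ j, 0 < (![A, B, C, D] : Fin 4 → ℝ) j := by
  intro j
  fin_cases j <;> simpa

theorem tsum_poisedTerm_contiguous (hq : ‖q‖ < 1) (hq0 : q ≠ 0) (hx : x ≠ 0) (hA : 0 < A)
    (hB : 0 < B) (hC : 0 < C) (hD : 0 < D) (h1 : ‖q‖ * (A * B * C * D) < 1) (ha : ‖a‖ ≤ A)
    (hb : ‖b‖ ≤ B) (hc : ‖c‖ ≤ C) (hd : ‖d‖ ≤ D) :
    (1 - q * a * b * c * d) * ∑' m, poisedTerm q ![a, b, c, d] m x =
      (1 - q * a * b) * (1 - q * a * c) * (1 - q * a * d) *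
        ∑' m, poisedTerm q ![q * a, b, c, d] m x := by
  have hpos := forall_vec_pos hA hB hC hD
  have h1' : ‖q‖ * ∏ j, ![A, B, C, D] j < 1 := by simpa [Fin.prod_univ_four] using h1
  have hqa : ‖q * a‖ ≤ ‖q‖ * A := by
    rw [norm_mul]
    gcongr
  have hs := summable_poisedTerm hq hq0 hpos h1' (forall_norm_vec_le ha hb hc hd) hx
  have hs' := summable_poisedTerm hq hq0 hpos h1' (forall_norm_vec_le
    (hqa.trans (mul_le_of_le_one_left hA.le hq.le)) hb hc hd) hx
  -- The first parameter is bounded by `‖q‖ * A`, not just `A`; this yields the stronger condition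
  -- that the certificate requires.
  have hD' := summable_poisedCert hq hq0
    (forall_vec_pos (mul_pos (norm_pos_iff.2 hq0) hA) hB hC hD)
    (by simpa [Fin.prod_univ_four, mul_assoc] using h1) (forall_norm_vec_le hqa hb hc hd) hx
  have hshift : Summable fun m : ℤ => poisedCert q ![q * a, b, c, d] (m + 1) x :=
    ((Equiv.addRight (1 : ℤ)).summable_iff).2 hD'
  have e : ∑' m : ℤ, poisedCert q ![q * a, b, c, d] (m + 1) x =
      ∑' m, poisedCert q ![q * a, b, c, d] m x :=
    (Equiv.addRight (1 : ℤ)).tsum_eq fun m => poisedCert q ![q * a, b, c, d] m x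
  rw [← tsum_mul_left, ← tsum_mul_left, tsum_congr fun m => poisedTerm_contiguous hq hq0 hx m,
    (hs'.mul_left _).tsum_add ((hshift.sub hD').mul_left _), tsum_mul_left (a := q * a),
    hshift.tsum_sub hD', e, sub_self, mul_zero, add_zero]

theorem continuous_poisedTerm_first (hq : ‖q‖ < 1) (b c d : ℂ) (m : ℤ) (x : ℂ) :
    Continuous fun a => poisedTerm q ![a, b, c, d] m x := by
  simp only [poisedTerm, poisedCore, Fin.prod_univ_four, Matrix.cons_val]
  have := (continuous_qPochPair hq (q ^ m * x)).comp (continuous_const_mul q)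
  simp only [Function.comp_def] at this
  fun_prop

theorem tsum_poisedTerm_step (hq : ‖q‖ < 1) (hq0 : q ≠ 0) (hx : x ≠ 0) (hA : 0 < A)
    (hB : 0 < B) (hC : 0 < C) (hD : 0 < D) (h1 : ‖q‖ * (A * B * C * D) < 1) (ha : ‖a‖ ≤ A)
    (hb : ‖b‖ ≤ B) (hc : ‖c‖ ≤ C) (hd : ‖d‖ ≤ D) :
    qPochInf (q * a * b * c * d) q * ∑' m, poisedTerm q ![a, b, c, d] m x =
      qPochInf (q * a * b) q * qPochInf (q * a * c) q * qPochInf (q * a * d) q *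
        ∑' m, poisedTerm q ![0, b, c, d] m x := by
  have h1' : ‖q‖ * ∏ j, ![A, B, C, D] j < 1 := by simpa [Fin.prod_univ_four] using h1
  have han : ∀ n : ℕ, ‖a * q ^ n‖ ≤ A := fun n => by
    rw [norm_mul, norm_pow]
    exact (mul_le_of_le_one_right (norm_nonneg a) (pow_le_one₀ (norm_nonneg q) hq.le)).trans ha
  have h0 : Tendsto (fun n : ℕ => a * q ^ n) atTop (𝓝 0) := by
    simpa using (tendsto_pow_atTop_nhds_zero_of_norm_lt_one hq).const_mul a
  obtain ⟨u, hu, hle⟩ := exists_summable_norm_poisedTerm_le hq hq0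
    (forall_vec_pos hA hB hC hD) h1' (norm_pos_iff.2 hx) ‖x‖
  have hlim : Tendsto (fun n : ℕ => ∑' m, poisedTerm q ![a * q ^ n, b, c, d] m x) atTop
      (𝓝 (∑' m, poisedTerm q ![0, b, c, d] m x)) :=
    tendsto_tsum_of_dominated_convergence hu
      (fun m => ((continuous_poisedTerm_first hq b c d m x).tendsto 0).comp h0)
      (.of_forall fun n m => hle m _ x (forall_norm_vec_le (han n) hb hc hd) le_rfl le_rfl)
  have := mul_eq_mul_of_tendsto_of_recurrence (tendsto_prod_qPochInf hq (q * a * b * c * d))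
    (tendsto_prod_three_qPochInf hq (q * a * b) (q * a * c) (q * a * d)) hlim fun n => by
      have := tsum_poisedTerm_contiguous hq hq0 hx hA hB hC hD h1 (han n) hb hc hd
      rw [show q * (a * q ^ n) = a * q ^ (n + 1) by ring] at this
      linear_combination this
  simpa using this

/-- Bailey's summation of the very-well-poised bilateral series, relative to the series with all
parameters equal to zero. -/
theorem tsum_poisedTerm_eq (hq : ‖q‖ < 1) (hq0 : q ≠ 0) (hx : x ≠ 0) (hA : 0 < A)
    (hB : 0 < B) (hC : 0 < C) (hD : 0 < D) (h1 : ‖q‖ * (A * B * C * D) < 1) (ha : ‖a‖ ≤ A)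
    (hb : ‖b‖ ≤ B) (hc : ‖c‖ ≤ C) (hd : ‖d‖ ≤ D) :
    qPochInf (q * a * b * c * d) q * ∑' m, poisedTerm q ![a, b, c, d] m x =
      qPochInf (q * a * b) q * qPochInf (q * a * c) q * qPochInf (q * a * d) q *
        (qPochInf (q * b * c) q * qPochInf (q * b * d) q * qPochInf (q * c * d) q) *
        ∑' m, poisedTerm q 0 m x := by
  have hz : ∀ {E : ℝ}, 0 < E → ‖(0 : ℂ)‖ ≤ E := fun h => by simpa using h.le
  have hperm1 : ‖q‖ * (B * C * D * A) < 1 := by convert h1 using 2; ring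
  have hperm2 : ‖q‖ * (C * D * A * B) < 1 := by convert h1 using 2; ring
  have hperm3 : ‖q‖ * (D * A * B * C) < 1 := by convert h1 using 2; ring
  have s1 := tsum_poisedTerm_step hq hq0 hx hA hB hC hD h1 ha hb hc hd
  -- An eliminated parameter stays in the list as `0` and keeps its positive bound, so the product
  -- of the bounds does not change.
  have s2 := tsum_poisedTerm_step hq hq0 hx hB hC hD hA hperm1 hb hc hd (hz hA)
  have s3 := tsum_poisedTerm_step hq hq0 hx hC hD hA hB hperm2 hc hd (hz hA) (hz hB)
  have s4 := tsum_poisedTerm_step hq hq0 hx hD hA hB hC hperm3 hd (hz hA) (hz hB) (hz hC)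
  simp only [mul_zero, qPochInf_zero, one_mul, mul_one] at s2 s3 s4
  have e0 : (![0, 0, 0, 0] : Fin 4 → ℂ) = 0 := by
    ext j
    fin_cases j <;> rfl
  rw [e0] at s4
  rw [s1, tsum_congr fun m => poisedTerm_rotate q 0 b c d m x, s2,
    tsum_congr fun m => poisedTerm_rotate q 0 c d 0 m x, s3,
    tsum_congr fun m => poisedTerm_rotate q 0 d 0 0 m x, s4]
  ring

end BilateralSummation

/-! ### The Askey–Wilson integral with a theta function in the numerator. -/

section AskeyWilson

open Filter Topology Set

variable {q : ℂ} {x z : ℂ} {a b c d : ℂ} {e : Fin 4 → ℂ} {p : ℂ} {γ : Path p p}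

theorem poisedTerm_zero (q : ℂ) (m : ℤ) (x : ℂ) :
    poisedTerm q 0 m x = (1 - (q ^ m * x) ^ 2) * (q ^ (2 * m ^ 2 - m) * x ^ (4 * m)) := by
  simp [poisedTerm, poisedCore, qPochPair_zero]

/-- The factor `q ^ m x` turns `x ↦ q x` into `m ↦ m + 1`, and the quadratic exponent supplies the
multiplier. Summed over `m`, this is the theta quasi-periodicity. -/
theorem poisedTerm_zero_mul (hq0 : q ≠ 0) (m : ℤ) (hx : x ≠ 0) :
    poisedTerm q 0 m (q * x) = q⁻¹ * (x ^ 4)⁻¹ * poisedTerm q 0 (m + 1) x := by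
  rw [poisedTerm_zero, poisedTerm_zero]
  have e1 : q ^ (m + 1) * x = q ^ m * (q * x) := by
    rw [zpow_add_one₀ hq0]
    ring
  have e2 : q ^ (2 * (m + 1) ^ 2 - (m + 1)) = q ^ (2 * m ^ 2 - m) * (q ^ (4 * m) * q) := by
    rw [← zpow_add_one₀ hq0, ← zpow_add₀ hq0]
    congr 1
    ring
  have e3 : x ^ (4 * (m + 1)) = x ^ (4 * m) * x ^ 4 := by
    rw [mul_add, mul_one, zpow_add₀ hx]
    rfl
  rw [e1, e2, e3, mul_zpow]
  field_simp

theorem tsum_poisedTerm_zero_mul (hq0 : q ≠ 0) (hx : x ≠ 0) :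
    ∑' m, poisedTerm q 0 m (q * x) = q⁻¹ * (x ^ 4)⁻¹ * ∑' m, poisedTerm q 0 m x := by
  rw [← (Equiv.addRight (1 : ℤ)).tsum_eq fun m => poisedTerm q 0 m x, ← tsum_mul_left]
  exact tsum_congr fun m => poisedTerm_zero_mul hq0 m hx

theorem differentiableAt_poisedTerm (hq : ‖q‖ < 1) (hq0 : q ≠ 0) (e : Fin 4 → ℂ) (m : ℤ)
    (hx : x ≠ 0) : DifferentiableAt ℂ (poisedTerm q e m) x := by
  have h : ∀ j, DifferentiableAt ℂ (fun x => qPochPair q (q * e j) (q ^ m * x)) x := fun j =>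
    (differentiableAt_qPochPair hq _ (mul_ne_zero (zpow_ne_zero m hq0) hx)).fun_comp' x
      (by fun_prop)
  have h' : DifferentiableAt ℂ (fun x : ℂ => x ^ (4 * m)) x :=
    differentiableAt_zpow.2 (Or.inl hx)
  unfold poisedTerm poisedCore
  refine DifferentiableAt.fun_mul (by fun_prop) (DifferentiableAt.fun_mul ?_ (h'.const_mul _))
  exact DifferentiableAt.fun_finsetProd fun j _ => h j

theorem exists_summable_norm_poisedTerm_zero_le (hq : ‖q‖ < 1) (hq0 : q ≠ 0) {r : ℝ} (hr : 0 < r)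
    (R : ℝ) : ∃ u : ℤ → ℝ, Summable u ∧ ∀ (m : ℤ) (x : ℂ),
      r ≤ ‖x‖ → ‖x‖ ≤ R → ‖poisedTerm q 0 m x‖ ≤ u m := by
  obtain ⟨u, hu, h⟩ := exists_summable_norm_poisedTerm_le hq hq0 (C := fun _ => 1)
    (fun _ => one_pos) (by simpa) hr R
  exact ⟨u, hu, fun m x => h m 0 x fun _ => by simp⟩

theorem differentiableAt_tsum_poisedTerm_zero (hq : ‖q‖ < 1) (hq0 : q ≠ 0) (hx : x ≠ 0) :
    DifferentiableAt ℂ (fun x => ∑' m, poisedTerm q 0 m x) x := by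
  have hxpos : 0 < ‖x‖ := norm_pos_iff.2 hx
  obtain ⟨u, hu, h⟩ := exists_summable_norm_poisedTerm_zero_le hq hq0 (half_pos hxpos) (2 * ‖x‖)
  have hopen : IsOpen {y : ℂ | ‖x‖ / 2 < ‖y‖ ∧ ‖y‖ < 2 * ‖x‖} :=
    (isOpen_lt continuous_const continuous_norm).inter (isOpen_lt continuous_norm continuous_const)
  refine (Complex.differentiableOn_tsum_of_summable_norm hu (fun m y hy => ?_) hopen
    fun m y hy => h m y hy.1.le hy.2.le).differentiableAt
      (hopen.mem_nhds ⟨half_lt_self hxpos, by linarith⟩)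
  exact (differentiableAt_poisedTerm hq hq0 0 m
    (norm_pos_iff.1 ((half_pos hxpos).trans hy.1))).differentiableWithinAt

/-- The theta function `∑ (-1) ^ n q ^ (n (n - 1) / 2) z ^ (-2 n)`, summed over pairs of terms. -/
noncomputable def poisedTheta (q z : ℂ) : ℂ := ∑' m, poisedTerm q 0 m z⁻¹

theorem differentiableAt_poisedTheta (hq : ‖q‖ < 1) (hq0 : q ≠ 0) (hz : z ≠ 0) :
    DifferentiableAt ℂ (poisedTheta q) z :=
  (differentiableAt_tsum_poisedTerm_zero hq hq0 (inv_ne_zero hz)).fun_comp' z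
    (by fun_prop (disch := assumption))

theorem poisedTheta_mul (hq0 : q ≠ 0) (hz : z ≠ 0) :
    poisedTheta q (q * z) = (q ^ 3 * z ^ 4)⁻¹ * poisedTheta q z := by
  have h := tsum_poisedTerm_zero_mul (x := (q * z)⁻¹) hq0 (by simp [hq0, hz])
  rw [show q * (q * z)⁻¹ = z⁻¹ by field_simp] at h
  rw [poisedTheta, poisedTheta, h]
  field_simp

/-- The Askey–Wilson weight with parameters `e`, divided by `z`. -/
noncomputable def awIntegrand (q : ℂ) (e : Fin 4 → ℂ) (z : ℂ) : ℂ :=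
  (1 - z ^ 2) * poisedTheta q z / z / ∏ j, qPochPair q (e j) z

theorem innerPoles_subset_of_mul_pow {e e' : Fin 4 → ℂ} (h : ∀ j, e' j = 0 ∨
    ∃ (i : Fin 4) (n : ℕ), e' j = e i * q ^ n) : innerPoles q e' ⊆ innerPoles q e := by
  rintro z (rfl | ⟨j, k, rfl⟩)
  · exact Or.inl rfl
  · rcases h j with h | ⟨i, n, h⟩
    · exact Or.inl (by rw [h, zero_mul])
    · exact Or.inr ⟨i, n + k, by rw [h, pow_add, mul_assoc]⟩

theorem outerPoles_subset_of_mul_pow {e e' : Fin 4 → ℂ} (h : ∀ j, e' j = 0 ∨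
    ∃ (i : Fin 4) (n : ℕ), e' j = e i * q ^ n) : outerPoles q e' ⊆ outerPoles q e := by
  rintro z ⟨j, k, hz⟩
  rcases h j with h | ⟨i, n, h⟩
  · simp [h] at hz
  · refine ⟨i, n + k, ?_⟩
    rw [h] at hz
    rw [pow_add]
    linear_combination hz

theorem IsSeparatingContour.mono {S T S' T' : Set ℂ} (h : IsSeparatingContour γ S T)
    (hS : S' ⊆ S) (hT : T' ⊆ T) : IsSeparatingContour γ S' T' :=
  ⟨h.piecewiseC1, fun t ht => h.avoids_inside t (hS ht), fun t ht => h.avoids_outside t (hT ht),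
    fun w hw => h.winding_inside w (hS hw), fun w hw => h.winding_outside w (hT hw)⟩

/-- Such changes of parameters only remove poles, so one fixed contour serves throughout the
iteration and its limit. -/
theorem IsSeparatingContour.of_mul_pow {e e' : Fin 4 → ℂ}
    (hγ : IsSeparatingContour γ (innerPoles q e) (outerPoles q e))
    (h : ∀ j, e' j = 0 ∨ ∃ (i : Fin 4) (n : ℕ), e' j = e i * q ^ n) :
    IsSeparatingContour γ (innerPoles q e') (outerPoles q e') :=
  hγ.mono (innerPoles_subset_of_mul_pow h) (outerPoles_subset_of_mul_pow h)

theorem IsSeparatingContour.qPochPair_ne_zero (hq : ‖q‖ < 1)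
    (hγ : IsSeparatingContour γ (innerPoles q e) (outerPoles q e)) {z : ℂ} (hz : z ∈ range γ)
    (j : Fin 4) : qPochPair q (e j) z ≠ 0 :=
  mul_ne_zero (hγ.qPochInf_mul_ne_zero hq hz j) (hγ.qPochInf_div_ne_zero hq hz j)

theorem IsSeparatingContour.continuousOn_div {e' : Fin 4 → ℂ} (hq : ‖q‖ < 1)
    (hγ : IsSeparatingContour γ (innerPoles q e') (outerPoles q e)) {N : ℂ → ℂ}
    (hN : ∀ z ≠ 0, DifferentiableAt ℂ N z) :
    ContinuousOn (fun z => N z / ∏ j, (qPochInf (e j * z) q * qPochInf (e' j / z) q))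
      (range γ) := by
  intro z hz
  have hz0 := hγ.ne_zero hz
  refine (DifferentiableAt.fun_div (hN z hz0) ?_ ?_).continuousAt.continuousWithinAt
  · refine DifferentiableAt.fun_finsetProd fun j _ => DifferentiableAt.fun_mul ?_ ?_
    · exact (differentiable_qPochInf hq _).fun_comp' z (by fun_prop)
    · exact (differentiable_qPochInf hq _).fun_comp' z (by fun_prop (disch := assumption))
  · exact Finset.prod_ne_zero_iff.2 fun j _ =>
      mul_ne_zero (hγ.qPochInf_mul_ne_zero hq hz j) (hγ.qPochInf_div_ne_zero hq hz j)

theorem differentiableAt_awNumerator (hq : ‖q‖ < 1) (hq0 : q ≠ 0) (hz : z ≠ 0) :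
    DifferentiableAt ℂ (fun z => (1 - z ^ 2) * poisedTheta q z / z) z := by
  have := differentiableAt_poisedTheta hq hq0 hz
  fun_prop (disch := assumption)

theorem continuousOn_awIntegrand (hq : ‖q‖ < 1) (hq0 : q ≠ 0)
    (hγ : IsSeparatingContour γ (innerPoles q e) (outerPoles q e)) :
    ContinuousOn (awIntegrand q e) (range γ) :=
  hγ.continuousOn_div hq fun _ hz => differentiableAt_awNumerator hq hq0 hz

/-- The function whose shift gives the contiguous relation for the Askey–Wilson integral. -/
noncomputable def awCert (q : ℂ) (e : Fin 4 → ℂ) (z : ℂ) : ℂ :=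
  z ^ 2 * poisedTheta q z / ∏ j, (qPochInf (e j * z) q * qPochInf (q * e j / z) q)

theorem differentiableAt_awCertNumerator (hq : ‖q‖ < 1) (hq0 : q ≠ 0) (hz : z ≠ 0) :
    DifferentiableAt ℂ (fun z => z ^ 2 * poisedTheta q z) z := by
  have := differentiableAt_poisedTheta hq hq0 hz
  fun_prop

theorem IsSeparatingContour.mul_inner (hγ : IsSeparatingContour γ (innerPoles q e) (outerPoles q e)) :
    IsSeparatingContour γ (innerPoles q fun j => q * e j) (outerPoles q e) :=
  hγ.mono (innerPoles_subset_of_mul_pow fun j => Or.inr ⟨j, 1, by ring⟩) subset_rfl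

/-- Scaling by `q` carries the inner poles of `e` onto those of `q e`. The scaled outer poles
contain the original ones, because `q ^ (-k) / e_j = q · q ^ (-(k + 1)) / e_j`. -/
theorem IsSeparatingContour.mulLeft_self (hq0 : q ≠ 0)
    (hγ : IsSeparatingContour γ (innerPoles q e) (outerPoles q e)) :
    IsSeparatingContour (γ.mulLeft q) (innerPoles q fun j => q * e j) (outerPoles q e) := by
  have hT : outerPoles q e ⊆ (q⁻¹ * ·) ⁻¹' outerPoles q e := by
    rintro z ⟨j, k, hz⟩
    refine ⟨j, k + 1, ?_⟩
    rw [pow_succ]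
    field_simp
    exact hz
  refine (hγ.mulLeft (T' := (q⁻¹ * ·) ⁻¹' outerPoles q e) hq0 (fun z => ?_)
    fun z => ?_).mono subset_rfl hT
  · constructor
    · rintro (h | ⟨j, k, h⟩)
      · exact Or.inl ((mul_eq_zero.1 h).resolve_left hq0)
      · exact Or.inr ⟨j, k, mul_left_cancel₀ hq0 (by rw [h]; ring)⟩
    · rintro (h | ⟨j, k, h⟩)
      · exact Or.inl (by rw [h, mul_zero])
      · exact Or.inr ⟨j, k, by rw [h]; ring⟩
  · simp [inv_mul_cancel_left₀ hq0]

/-- The inner poles of `awCert` start at `q e_j`, hence `γ` and `q γ` both separate its poles. This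
is the counterpart of the telescoping sum. -/
theorem lineIntegral_awCert_mul (hq : ‖q‖ < 1) (hq0 : q ≠ 0)
    (hγ : IsSeparatingContour γ (innerPoles q e) (outerPoles q e)) :
    lineIntegral (fun z => q * awCert q e (q * z)) γ = lineIntegral (awCert q e) γ := by
  rw [← lineIntegral_mulLeft]
  exact lineIntegral_eq_of_isSeparatingContour hq (hγ.mulLeft_self hq0) hγ.mul_inner
    fun z hz => differentiableAt_awCertNumerator hq hq0 hz

theorem continuousOn_awCert_mul (hq : ‖q‖ < 1) (hq0 : q ≠ 0)
    (hγ : IsSeparatingContour γ (innerPoles q e) (outerPoles q e)) :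
    ContinuousOn (fun z => q * awCert q e (q * z)) (range γ) := by
  have h : ContinuousOn (awCert q e) (range (γ.mulLeft q)) :=
    (hγ.mulLeft_self hq0).continuousOn_div hq fun _ hz => differentiableAt_awCertNumerator hq hq0 hz
  refine continuousOn_const.mul (h.comp (by fun_prop) ?_)
  rintro _ ⟨t, rfl⟩
  exact ⟨t, rfl⟩

/-- Over the common denominator `∏ (e_j z, e_j / z; q)_∞`, the numerator of `awCert` at `z` is `z ^
2 θ(z) ∏ (1 - e_j / z)`. By quasi-periodicity that of its shift is `z ^ (-2) θ(z) ∏ (1 - e_j z)`. A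
rational identity remains. -/
theorem awIntegrand_contiguous (hq : ‖q‖ < 1) (hq0 : q ≠ 0) (hz : z ≠ 0)
    (hne : ∀ j, qPochPair q (![a, b, c, d] j) z ≠ 0) :
    (1 - a * b * c * d) * awIntegrand q ![q * a, b, c, d] z =
      (1 - a * b) * (1 - a * c) * (1 - a * d) * awIntegrand q ![a, b, c, d] z +
        a * (awCert q ![a, b, c, d] z - q * awCert q ![a, b, c, d] (q * z)) := by
  set e : Fin 4 → ℂ := ![a, b, c, d] with he
  have hP : ∏ j, qPochPair q (e j) z ≠ 0 := Finset.prod_ne_zero_iff.2 fun j _ => hne j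
  have hA1 : ∀ j, 1 - e j * z ≠ 0 := fun j h => hne j (by
    rw [qPochPair_eq_mul hq, h, zero_mul, zero_mul])
  have hA2 : ∀ j, 1 - e j / z ≠ 0 := fun j h => hne j (by
    rw [qPochPair_eq_mul hq, h, mul_zero, zero_mul])
  have hprod1 : ∏ j, (1 - e j * z) ≠ 0 := Finset.prod_ne_zero_iff.2 fun j _ => hA1 j
  have hprod2 : ∏ j, (1 - e j / z) ≠ 0 := Finset.prod_ne_zero_iff.2 fun j _ => hA2 j
  have e1 : awCert q e z = z ^ 2 * poisedTheta q z * (∏ j, (1 - e j / z)) /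
      ∏ j, qPochPair q (e j) z := by
    have : ∏ j, qPochPair q (e j) z =
        (∏ j, (1 - e j / z)) * ∏ j, (qPochInf (e j * z) q * qPochInf (q * e j / z) q) := by
      rw [← Finset.prod_mul_distrib]
      refine Finset.prod_congr rfl fun j _ => ?_
      rw [qPochPair, qPochInf_eq_one_sub_mul hq (e j / z), show e j / z * q = q * e j / z by ring]
      ring
    rw [awCert, this, mul_comm (z ^ 2 * poisedTheta q z), mul_div_mul_left _ _ hprod2]
  have e2 : q * awCert q e (q * z) = (z ^ 2)⁻¹ * poisedTheta q z * (∏ j, (1 - e j * z)) /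
      ∏ j, qPochPair q (e j) z := by
    have : ∏ j, qPochPair q (e j) z = (∏ j, (1 - e j * z)) *
        ∏ j, (qPochInf (e j * (q * z)) q * qPochInf (q * e j / (q * z)) q) := by
      rw [← Finset.prod_mul_distrib]
      refine Finset.prod_congr rfl fun j _ => ?_
      rw [qPochPair, qPochInf_eq_one_sub_mul hq (e j * z), show e j * z * q = e j * (q * z) by ring,
        mul_div_mul_left _ _ hq0]
      ring
    rw [awCert, this, mul_comm ((z ^ 2)⁻¹ * poisedTheta q z), mul_div_mul_left _ _ hprod1,
      poisedTheta_mul hq0 hz]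
    field_simp
  have e3 : awIntegrand q ![q * a, b, c, d] z = (1 - a * z) * (1 - a / z) * awIntegrand q e z := by
    have h1 : 1 - a * z ≠ 0 := hA1 0
    have h2 : 1 - a / z ≠ 0 := hA2 0
    have : ∏ j, qPochPair q (e j) z =
        ((1 - a * z) * (1 - a / z)) * ∏ j, qPochPair q (![q * a, b, c, d] j) z := by
      simp only [he, Fin.prod_univ_four, Matrix.cons_val]
      rw [qPochPair_eq_mul hq a]
      ring
    rw [awIntegrand, awIntegrand, this, mul_div_assoc', mul_div_mul_left _ _ (mul_ne_zero h1 h2)]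
  rw [e1, e2, e3, awIntegrand]
  simp only [Fin.prod_univ_four] at hP ⊢
  generalize qPochPair q (e 0) z * qPochPair q (e 1) z * qPochPair q (e 2) z *
    qPochPair q (e 3) z = P at hP
  simp only [he, Matrix.cons_val]
  field_simp
  ring

theorem lineIntegral_awIntegrand_contiguous (hq : ‖q‖ < 1) (hq0 : q ≠ 0)
    (hγ : IsSeparatingContour γ (innerPoles q ![a, b, c, d]) (outerPoles q ![a, b, c, d])) :
    (1 - a * b) * (1 - a * c) * (1 - a * d) * lineIntegral (awIntegrand q ![a, b, c, d]) γ =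
      (1 - a * b * c * d) * lineIntegral (awIntegrand q ![q * a, b, c, d]) γ := by
  have hpc := hγ.piecewiseC1Path
  have hcert : ContinuousOn (awCert q ![a, b, c, d]) (range γ) :=
    hγ.mul_inner.continuousOn_div hq fun _ hz => differentiableAt_awCertNumerator hq hq0 hz
  have hint := continuousOn_awIntegrand hq hq0 hγ
  have e := lineIntegral_congr (γ := γ) fun z hz => awIntegrand_contiguous hq hq0 (hγ.ne_zero hz)
    fun j => hγ.qPochPair_ne_zero hq hz j
  have hcert' := continuousOn_awCert_mul hq hq0 hγ
  rw [lineIntegral_const_mul, lineIntegral_add hpc (f := fun z => _ * _) (g := fun z => _ * (_ - _))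
    (continuousOn_const.mul hint) (continuousOn_const.mul (hcert.sub hcert')),
    lineIntegral_const_mul, lineIntegral_const_mul,
    lineIntegral_sub hpc hcert hcert', lineIntegral_awCert_mul hq hq0 hγ, sub_self, mul_zero,
    add_zero] at e
  exact e.symm

theorem qPochPair_eq_prod_mul (hq : ‖q‖ < 1) (e y : ℂ) (n : ℕ) :
    qPochPair q e y = (∏ i ∈ Finset.range n, (1 - e * y * q ^ i)) *
      (∏ i ∈ Finset.range n, (1 - e / y * q ^ i)) * qPochPair q (e * q ^ n) y := by
  rw [qPochPair, qPochPair, qPochInf_eq_prod_mul hq (e * y) n, qPochInf_eq_prod_mul hq (e / y) n]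
  ring_nf

theorem norm_prod_one_sub_le (hq : ‖q‖ < 1) {v : ℂ} {B : ℝ} (hv : ‖v‖ ≤ B) (n : ℕ) :
    ‖∏ i ∈ Finset.range n, (1 - v * q ^ i)‖ ≤ Real.exp (B * (1 - ‖q‖)⁻¹) := by
  rw [norm_prod]
  refine (Finset.prod_le_prod (fun _ _ => norm_nonneg _) fun i _ => ?_).trans
    (prod_one_add_pow_le (norm_nonneg q) hq ((norm_nonneg v).trans hv) n)
  refine (norm_sub_le _ _).trans ?_
  rw [norm_one, norm_mul, norm_pow]
  gcongr

theorem IsSeparatingContour.first_mul_pow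
    (hγ : IsSeparatingContour γ (innerPoles q ![a, b, c, d]) (outerPoles q ![a, b, c, d])) (n : ℕ) :
    IsSeparatingContour γ (innerPoles q ![a * q ^ n, b, c, d])
      (outerPoles q ![a * q ^ n, b, c, d]) := by
  refine hγ.of_mul_pow fun j => Or.inr ?_
  fin_cases j
  exacts [⟨0, n, rfl⟩, ⟨1, 0, by simp⟩, ⟨2, 0, by simp⟩, ⟨3, 0, by simp⟩]

theorem IsSeparatingContour.first_zero
    (hγ : IsSeparatingContour γ (innerPoles q ![a, b, c, d]) (outerPoles q ![a, b, c, d])) :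
    IsSeparatingContour γ (innerPoles q ![0, b, c, d]) (outerPoles q ![0, b, c, d]) := by
  refine hγ.of_mul_pow fun j => ?_
  fin_cases j
  exacts [Or.inl rfl, Or.inr ⟨1, 0, by simp⟩, Or.inr ⟨2, 0, by simp⟩, Or.inr ⟨3, 0, by simp⟩]

theorem IsSeparatingContour.rotate
    (hγ : IsSeparatingContour γ (innerPoles q ![a, b, c, d]) (outerPoles q ![a, b, c, d])) :
    IsSeparatingContour γ (innerPoles q ![b, c, d, a]) (outerPoles q ![b, c, d, a]) := by
  refine hγ.of_mul_pow fun j => Or.inr ?_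
  fin_cases j
  exacts [⟨1, 0, by simp⟩, ⟨2, 0, by simp⟩, ⟨3, 0, by simp⟩, ⟨0, 0, by simp⟩]

theorem awIntegrand_rotate (q a b c d : ℂ) :
    awIntegrand q ![a, b, c, d] = awIntegrand q ![b, c, d, a] := by
  ext z
  simp only [awIntegrand, Fin.prod_univ_four, Matrix.cons_val]
  congr 1
  ring

/-- The integrand at `a q ^ n` is the integrand at `a` times finite products that are bounded
uniformly in `n`. This gives domination without a lower bound for the varying denominators. -/
theorem tendsto_lineIntegral_awIntegrand (hq : ‖q‖ < 1) (hq0 : q ≠ 0)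
    (hγ : IsSeparatingContour γ (innerPoles q ![a, b, c, d]) (outerPoles q ![a, b, c, d])) :
    Tendsto (fun n : ℕ => lineIntegral (awIntegrand q ![a * q ^ n, b, c, d]) γ) atTop
      (𝓝 (lineIntegral (awIntegrand q ![0, b, c, d]) γ)) := by
  obtain ⟨r, R, hr, hb⟩ := exists_norm_bounds_of_zero_notMem γ fun h => hγ.ne_zero h rfl
  obtain ⟨M, hM⟩ := (isCompact_range γ.continuous).exists_bound_of_continuousOn
    (continuousOn_awIntegrand hq hq0 hγ)
  refine tendsto_lineIntegral hγ.piecewiseC1Path (C := Real.exp (‖a‖ * R * (1 - ‖q‖)⁻¹) *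
    Real.exp (‖a‖ / r * (1 - ‖q‖)⁻¹) * M)
    (fun n => continuousOn_awIntegrand hq hq0 (hγ.first_mul_pow n)) (fun n z hz => ?_)
    fun z hz => ?_
  · have hP := hγ.qPochPair_ne_zero hq hz 0
    simp only [Matrix.cons_val] at hP
    rw [qPochPair_eq_prod_mul hq a z n] at hP
    have e : awIntegrand q ![a * q ^ n, b, c, d] z =
        (∏ i ∈ Finset.range n, (1 - a * z * q ^ i)) * (∏ i ∈ Finset.range n, (1 - a / z * q ^ i)) *
          awIntegrand q ![a, b, c, d] z := by
      have e' : ∏ j, qPochPair q (![a, b, c, d] j) z = ((∏ i ∈ Finset.range n, (1 - a * z * q ^ i)) *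
          ∏ i ∈ Finset.range n, (1 - a / z * q ^ i)) *
          ∏ j, qPochPair q (![a * q ^ n, b, c, d] j) z := by
        simp only [Fin.prod_univ_four, Matrix.cons_val]
        rw [qPochPair_eq_prod_mul hq a z n]
        ring
      rw [awIntegrand, awIntegrand, e', mul_div_assoc',
        mul_div_mul_left _ _ (left_ne_zero_of_mul hP)]
    rw [e, norm_mul, norm_mul]
    gcongr
    · refine norm_prod_one_sub_le hq ?_ n
      rw [norm_mul]
      gcongr
      exact (hb z hz).2.le
    · refine norm_prod_one_sub_le hq ?_ n
      rw [norm_div]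
      gcongr
      exact (hb z hz).1.le
    · exact hM z hz
  · have h0 : Tendsto (fun n : ℕ => a * q ^ n) atTop (𝓝 0) := by
      simpa using (tendsto_pow_atTop_nhds_zero_of_norm_lt_one hq).const_mul a
    have hne : ∏ j, qPochPair q (![0, b, c, d] j) z ≠ 0 :=
      Finset.prod_ne_zero_iff.2 fun j _ => hγ.first_zero.qPochPair_ne_zero hq hz j
    have hc := ((continuous_qPochPair hq z).tendsto 0).comp h0
    simp only [awIntegrand, Fin.prod_univ_four, Matrix.cons_val] at hne ⊢
    exact tendsto_const_nhds.div (((hc.mul_const _).mul_const _).mul_const _) hne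

theorem lineIntegral_awIntegrand_step (hq : ‖q‖ < 1) (hq0 : q ≠ 0)
    (hγ : IsSeparatingContour γ (innerPoles q ![a, b, c, d]) (outerPoles q ![a, b, c, d])) :
    qPochInf (a * b) q * qPochInf (a * c) q * qPochInf (a * d) q *
        lineIntegral (awIntegrand q ![a, b, c, d]) γ =
      qPochInf (a * b * c * d) q * lineIntegral (awIntegrand q ![0, b, c, d]) γ := by
  have := mul_eq_mul_of_tendsto_of_recurrence
    (tendsto_prod_three_qPochInf hq (a * b) (a * c) (a * d))
    (tendsto_prod_qPochInf hq (a * b * c * d)) (tendsto_lineIntegral_awIntegrand hq hq0 hγ)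
    fun n => by
      have := lineIntegral_awIntegrand_contiguous hq hq0 (hγ.first_mul_pow n)
      rw [show q * (a * q ^ n) = a * q ^ (n + 1) by ring] at this
      linear_combination this
  simpa using this

theorem lineIntegral_zpow (hγ : PiecewiseC1Path γ) (h0 : (0 : ℂ) ∉ range γ) {k : ℤ}
    (hk : k ≠ -1) : lineIntegral (fun z => z ^ k) γ = 0 := by
  have hk' : (k + 1 : ℂ) ≠ 0 := by
    rw [ne_eq, ← eq_neg_iff_add_eq_zero]
    exact_mod_cast hk
  have hne : ∀ z ∈ range γ, z ≠ 0 := fun z hz h => h0 (h ▸ hz)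
  rw [lineIntegral_eq_sub_of_hasDerivAt hγ (F := fun z => z ^ (k + 1) / (k + 1))
    (fun z hz => (continuousAt_zpow₀ z k (Or.inl (hne z hz))).continuousWithinAt), sub_self]
  intro z hz
  have := (hasDerivAt_zpow (k + 1) z (Or.inl (hne z hz))).div_const (k + 1 : ℂ)
  have e : ((k + 1 : ℤ) : ℂ) * z ^ (k + 1 - 1) / (k + 1) = z ^ k := by
    push_cast
    rw [mul_div_right_comm, div_self hk', one_mul, add_sub_cancel_right]
  rwa [e] at this

/-- The exponents that occur are `-4 m - 1`, `-4 m - 3` and `-4 m + 1`. Only the first can be `-1`,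
and then `m = 0` with coefficient `1 + 1 = 2`: the source of the factor `2` in the final formula. -/
theorem lineIntegral_poisedTerm_zero
    (hγ : IsSeparatingContour γ (innerPoles q e) (outerPoles q e)) (m : ℤ) :
    lineIntegral (fun z => (1 - z ^ 2) * poisedTerm q 0 m z⁻¹ / z) γ =
      if m = 0 then 2 * (2 * Real.pi * Complex.I) else 0 := by
  have h0 : (0 : ℂ) ∉ range γ := fun h => hγ.ne_zero h rfl
  have hpc := hγ.piecewiseC1Path
  have hc : ∀ (A : ℂ) (k : ℤ), ContinuousOn (fun z : ℂ => A * z ^ k) (range γ) := fun A k =>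
    continuousOn_const.mul fun z hz =>
      (continuousAt_zpow₀ z k (Or.inl (hγ.ne_zero hz))).continuousWithinAt
  set A := q ^ (2 * m ^ 2 - m) with hA
  have e1 : ∀ z ∈ range γ, (1 - z ^ 2) * poisedTerm q 0 m z⁻¹ / z =
      A * (1 + (q ^ m) ^ 2) * z ^ (-4 * m - 1) -
        (A * (q ^ m) ^ 2 * z ^ (-4 * m - 3) + A * z ^ (-4 * m + 1)) := by
    intro z hz
    have hz0 := hγ.ne_zero hz
    have h1 : z ^ (-4 * m - 1) = z ^ (-4 * m) / z := zpow_sub_one₀ hz0 _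
    have h3 : z ^ (-4 * m - 3) = z ^ (-4 * m) / z ^ 3 := zpow_sub₀ hz0 _ _
    have h2 : z ^ (-4 * m + 1) = z ^ (-4 * m) * z := zpow_add_one₀ hz0 _
    have h4 : z⁻¹ ^ (4 * m) = z ^ (-4 * m) := by
      rw [inv_zpow']
      congr 1
      ring
    rw [poisedTerm_zero, h1, h2, h3, h4, ← hA]
    field_simp
    ring
  rw [lineIntegral_congr e1, lineIntegral_sub hpc (hc _ _) (g := fun z => _ * _ + _ * _)
    ((hc _ _).add (hc _ _)), lineIntegral_add hpc (hc _ _) (hc _ _)]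
  simp only [lineIntegral_const_mul]
  rw [lineIntegral_zpow hpc h0 (k := -4 * m - 3) (by omega),
    lineIntegral_zpow hpc h0 (k := -4 * m + 1) (by omega)]
  split_ifs with hm
  · subst hm
    have hw := hγ.winding_inside 0 (Or.inl rfl)
    rw [windingNumber_eq, inv_mul_eq_iff_eq_mul₀ Complex.two_pi_I_ne_zero, mul_one] at hw
    simp only [sub_zero] at hw
    simp only [mul_zero, zero_sub, zpow_neg_one, hw, hA]
    norm_num
  · rw [lineIntegral_zpow hpc h0 (k := -4 * m - 1) (by omega)]
    ring

theorem lineIntegral_awIntegrand_zero (hq : ‖q‖ < 1) (hq0 : q ≠ 0)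
    (hγ : IsSeparatingContour γ (innerPoles q e) (outerPoles q e)) :
    lineIntegral (awIntegrand q 0) γ = 2 * (2 * Real.pi * Complex.I) := by
  obtain ⟨r, R, hr, hb⟩ := exists_norm_bounds_of_zero_notMem γ fun h => hγ.ne_zero h rfl
  have hR : 0 < R := hr.trans ((hb p ⟨0, by simp⟩).1.trans (hb p ⟨0, by simp⟩).2)
  obtain ⟨u, hu, hle⟩ := exists_summable_norm_poisedTerm_zero_le hq hq0 (inv_pos.2 hR) r⁻¹
  have hs := hasSum_lineIntegral hγ.piecewiseC1Path
    (F := fun m z => (1 - z ^ 2) * poisedTerm q 0 m z⁻¹ / z)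
    (u := fun m => (1 + R ^ 2) * u m / r) ((hu.mul_left _).div_const r)
    (fun m z hz => ?_) fun m z hz => ?_
  · simp only [lineIntegral_poisedTerm_zero hγ] at hs
    rw [(hasSum_ite_eq (0 : ℤ) (2 * (2 * Real.pi * Complex.I))).unique hs]
    refine lineIntegral_congr fun z hz => ?_
    simp only [awIntegrand, Pi.zero_apply, qPochPair_zero, Finset.prod_const_one, div_one,
      poisedTheta]
    rw [tsum_div_const, tsum_mul_left]
  · have hz0 := hγ.ne_zero hz
    have := (differentiableAt_poisedTerm hq hq0 0 m (inv_ne_zero hz0)).fun_comp' z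
      (f := fun z => z⁻¹) (by fun_prop (disch := assumption))
    refine DifferentiableAt.continuousAt (𝕜 := ℂ) ?_ |>.continuousWithinAt
    fun_prop (disch := assumption)
  · rw [norm_div, norm_mul]
    have h1 := hb z hz
    have hzpos := hr.trans h1.1
    have h2 : ‖poisedTerm q 0 m z⁻¹‖ ≤ u m := by
      refine hle m _ ?_ ?_ <;> rw [norm_inv] <;> gcongr
      exacts [h1.2.le, h1.1.le]
    gcongr
    · have := (norm_nonneg _).trans h2
      positivity
    · refine (norm_sub_le _ _).trans ?_
      rw [norm_one, norm_pow]
      gcongr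
      exact h1.2.le
    · exact h1.1.le

/-- The Askey–Wilson integral. -/
theorem lineIntegral_awIntegrand_eq (hq : ‖q‖ < 1) (hq0 : q ≠ 0)
    (hγ : IsSeparatingContour γ (innerPoles q ![a, b, c, d]) (outerPoles q ![a, b, c, d])) :
    qPochInf (a * b) q * qPochInf (a * c) q * qPochInf (a * d) q *
        (qPochInf (b * c) q * qPochInf (b * d) q * qPochInf (c * d) q) *
        lineIntegral (awIntegrand q ![a, b, c, d]) γ =
      qPochInf (a * b * c * d) q * (2 * (2 * Real.pi * Complex.I)) := by
  -- Zeroing the first parameter and rotating brings the next one to the front, on the same contour.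
  have h2 := hγ.first_zero.rotate
  have h3 := h2.first_zero.rotate
  have h4 := h3.first_zero.rotate
  have s1 := lineIntegral_awIntegrand_step hq hq0 hγ
  have s2 := lineIntegral_awIntegrand_step hq hq0 h2
  have s3 := lineIntegral_awIntegrand_step hq hq0 h3
  have s4 := lineIntegral_awIntegrand_step hq hq0 h4
  have e0 : (![0, 0, 0, 0] : Fin 4 → ℂ) = 0 := by
    ext j
    fin_cases j <;> rfl
  simp only [mul_zero, qPochInf_zero, one_mul, mul_one, e0,
    lineIntegral_awIntegrand_zero hq hq0 hγ] at s2 s3 s4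
  rw [awIntegrand_rotate q 0 b c d] at s1
  rw [awIntegrand_rotate q 0 c d 0] at s2
  rw [awIntegrand_rotate q 0 d 0 0, s4] at s3
  rw [← s3, mul_left_comm, ← mul_assoc]
  linear_combination (qPochInf (b * c) q * qPochInf (b * d) q * qPochInf (c * d) q) * s1 +
    qPochInf (a * b * c * d) q * qPochInf (c * d) q * s2

end AskeyWilson

/-! ### Change of variables and combination of the two evaluations. -/

section Assembly

open Set

variable {q s : ℂ} {a b : Fin 4 → ℂ} {p : ℂ} {γ : Path p p}

theorem mul_mem_polesToZero (hs : s ≠ 0) (b : Fin 4 → ℂ) (m : ℤ) (z : ℂ) :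
    s ^ (-m) * z ∈ polesToZero q s b m ↔ z ∈ innerPoles q b := by
  have h : s ^ (-m) ≠ 0 := zpow_ne_zero _ hs
  simp only [polesToZero, innerPoles, mem_ofPred_eq, mul_eq_zero, h, false_or, mul_assoc,
    mul_right_inj' h]

theorem mul_mem_polesToInfinity (hs : s ≠ 0) (b : Fin 4 → ℂ) (m : ℤ) (z : ℂ) :
    s ^ (-m) * z ∈ polesToInfinity q s b m ↔ z ∈ outerPoles q b := by
  have h : ∀ j, s ^ m * b j * (s ^ (-m) * z) = b j * z := fun j => by
    have := zpow_ne_zero m hs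
    rw [zpow_neg]
    field_simp
  simp only [polesToInfinity, outerPoles, mem_ofPred_eq, h]

/-- With `u = s ^ m z` one has `q ^ m z ^ 2 = u ^ 2` and `q ^ m z ^ (-2) = (q ^ m / u) ^ 2`. Since
`(s ^ m) ^ (4 m) = q ^ (2 m ^ 2)`, the factor `1 / (q ^ m z ^ (4 m))` is the Gaussian weight of the
series at `1 / u`. -/
theorem wpIntegrand_eq (hq0 : q ≠ 0) (hs : s ^ 2 = q) (ha : ∀ j, a j ≠ 0) (b : Fin 4 → ℂ) (m : ℤ)
    {z : ℂ} (hz : z ≠ 0) :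
    wpIntegrand q s a b m z = (1 - (s ^ m * z) ^ 2) *
      poisedTerm q (fun j => (a j)⁻¹) m (s ^ m * z)⁻¹ / ∏ j, qPochPair q (b j) (s ^ m * z) := by
  have hs0 : s ≠ 0 := by
    rintro rfl
    exact hq0 (by rw [← hs]; ring)
  have hsm : s ^ m ≠ 0 := zpow_ne_zero m hs0
  have hqm : q ^ m = (s ^ m) ^ 2 := by
    rw [← hs, ← zpow_natCast, ← zpow_natCast, ← zpow_mul, ← zpow_mul, mul_comm]
  have e1 : ∀ j, qPochInf (q * s ^ m / (a j * z)) q * qPochInf (q * s ^ (-m) * z / a j) q =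
      qPochPair q (q * (a j)⁻¹) (q ^ m * (s ^ m * z)⁻¹) := fun j => by
    have haj := ha j
    rw [qPochPair, hqm, zpow_neg]
    congr 2 <;> field_simp
  have e2 : ∀ j, qPochInf (s ^ m * b j * z) q * qPochInf (s ^ (-m) * b j / z) q =
      qPochPair q (b j) (s ^ m * z) := fun j => by
    rw [qPochPair, zpow_neg]
    congr 2
    · ring
    · field_simp
  have e3 : q ^ (2 * m ^ 2 - m) * ((s ^ m * z)⁻¹) ^ (4 * m) = (q ^ m * z ^ (4 * m))⁻¹ := by
    have h : (s ^ m) ^ (4 * m) = q ^ (2 * m ^ 2) := by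
      rw [← hs, ← zpow_natCast, ← zpow_mul, ← zpow_mul]
      congr 1
      push_cast
      ring
    rw [inv_zpow, mul_zpow, h, zpow_sub₀ hq0]
    have := zpow_ne_zero (2 * m ^ 2) hq0
    field_simp
  have e4 : (1 - q ^ m * z ^ (-2 : ℤ)) = 1 - (q ^ m * (s ^ m * z)⁻¹) ^ 2 := by
    rw [hqm, show z ^ (-2 : ℤ) = (z ^ 2)⁻¹ by rw [zpow_neg]; rfl]
    field_simp
  have e5 : 1 - q ^ m * z ^ 2 = 1 - (s ^ m * z) ^ 2 := by
    rw [hqm]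
    ring
  rw [wpIntegrand, poisedTerm, poisedCore, e3, e4, e5]
  simp only [e1, e2, Finset.prod_div_distrib]
  ring

/-- The integrand in the variable `u = s ^ m z`, in which the contour does not depend on `m`. -/
noncomputable def scaledIntegrand (q : ℂ) (c b : Fin 4 → ℂ) (m : ℤ) (u : ℂ) : ℂ :=
  (1 - u ^ 2) * poisedTerm q c m u⁻¹ / (2 * Real.pi * Complex.I * u) / ∏ j, qPochPair q (b j) u

theorem differentiableAt_scaledNumerator (hq : ‖q‖ < 1) (hq0 : q ≠ 0) (c : Fin 4 → ℂ) (m : ℤ)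
    {u : ℂ} (hu : u ≠ 0) : DifferentiableAt ℂ
      (fun u => (1 - u ^ 2) * poisedTerm q c m u⁻¹ / (2 * Real.pi * Complex.I * u)) u := by
  have h := (differentiableAt_poisedTerm hq hq0 c m (inv_ne_zero hu)).fun_comp' u
    (f := fun z => z⁻¹) (by fun_prop (disch := assumption))
  have h2 : 2 * Real.pi * Complex.I * u ≠ 0 := mul_ne_zero Complex.two_pi_I_ne_zero hu
  fun_prop (disch := assumption)

/-- The contour scaled by `s ^ m` separates pole sets independent of `m`, so it may be replaced by a
fixed `γ₀`. -/
theorem contourIntegral_wpIntegrand_eq (hq : ‖q‖ < 1) (hq0 : q ≠ 0) (hs : s ^ 2 = q)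
    (ha : ∀ j, a j ≠ 0) (m : ℤ)
    (hγ : IsSeparatingContour γ (polesToZero q s b m) (polesToInfinity q s b m)) {p₀ : ℂ}
    {γ₀ : Path p₀ p₀} (hγ₀ : IsSeparatingContour γ₀ (innerPoles q b) (outerPoles q b)) :
    contourIntegral (fun z => wpIntegrand q s a b m z / (2 * (Real.pi : ℂ) * Complex.I * z)) γ =
      lineIntegral (scaledIntegrand q (fun j => (a j)⁻¹) b m) γ₀ := by
  have hs0 : s ≠ 0 := by
    rintro rfl
    exact hq0 (by rw [← hs]; ring)
  have hsm : s ^ m ≠ 0 := zpow_ne_zero m hs0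
  have hinv : ∀ z, s ^ (-m) * (s ^ m * z) = z := fun z => by
    rw [zpow_neg, inv_mul_cancel_left₀ hsm]
  have hγ' : IsSeparatingContour (γ.mulLeft (s ^ m)) (innerPoles q b) (outerPoles q b) :=
    hγ.mulLeft hsm (fun z => by rw [← mul_mem_polesToZero hs0 b m, hinv])
      fun z => by rw [← mul_mem_polesToInfinity hs0 b m, hinv]
  have e := lineIntegral_eq_of_isSeparatingContour hq hγ' hγ₀
    fun z hz => differentiableAt_scaledNumerator hq hq0 (fun j => (a j)⁻¹) m hz
  refine Eq.trans ?_ e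
  rw [lineIntegral_mulLeft, contourIntegral_eq_lineIntegral]
  refine lineIntegral_congr fun z hz => ?_
  have hz0 : z ≠ 0 := by
    rintro rfl
    obtain ⟨t, ht⟩ := hz
    exact hγ.avoids_inside t (ht ▸ Or.inl rfl)
  rw [wpIntegrand_eq hq0 hs ha b m hz0]
  change _ = s ^ m * ((1 - (s ^ m * z) ^ 2) * poisedTerm q (fun j => (a j)⁻¹) m (s ^ m * z)⁻¹ /
    (2 * Real.pi * Complex.I * (s ^ m * z)) / ∏ j, qPochPair q (b j) (s ^ m * z))
  have hI := Complex.two_pi_I_ne_zero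
  generalize (2 * Real.pi * Complex.I : ℂ) = I at hI
  generalize ∏ j, qPochPair q (b j) (s ^ m * z) = P
  generalize poisedTerm q (fun j => (a j)⁻¹) m (s ^ m * z)⁻¹ = T
  field_simp

theorem prod_Ioi_fin_four {M : Type*} [CommMonoid M] (f : Fin 4 → Fin 4 → M) :
    ∏ j : Fin 4, ∏ k ∈ Finset.Ioi j, f j k =
      f 0 1 * f 0 2 * f 0 3 * (f 1 2 * f 1 3) * f 2 3 := by
  have h0 : Finset.Ioi (0 : Fin 4) = {1, 2, 3} := rfl
  have h1 : Finset.Ioi (1 : Fin 4) = {2, 3} := rfl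
  have h2 : Finset.Ioi (2 : Fin 4) = {3} := rfl
  have h3 : Finset.Ioi (3 : Fin 4) = ∅ := rfl
  rw [Fin.prod_univ_four, h0, h1, h2, h3]
  simp [mul_assoc]

theorem hasSum_lineIntegral_scaledIntegrand (hq : ‖q‖ < 1) (hq0 : q ≠ 0) (ha : ∀ j, a j ≠ 0)
    (hconv : ‖q‖ < ‖∏ j, a j‖) (hb : ∀ (j k : Fin 4) (n : ℕ), b j * b k * q ^ n ≠ 1)
    (hγ : IsSeparatingContour γ (innerPoles q b) (outerPoles q b)) :
    HasSum (fun m => lineIntegral (scaledIntegrand q (fun j => (a j)⁻¹) b m) γ)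
      (2 * qPochInf (∏ j, b j) q / qPochInf (q / ∏ j, a j) q *
        ∏ j : Fin 4, ∏ k ∈ Finset.Ioi j,
          qPochInf (q / (a j * a k)) q / qPochInf (b j * b k) q) := by
  obtain ⟨r, R, hr, hbd⟩ := exists_norm_bounds_of_zero_notMem γ fun h => hγ.ne_zero h rfl
  have hR : 0 < R := hr.trans ((hbd p ⟨0, by simp⟩).1.trans (hbd p ⟨0, by simp⟩).2)
  have hpos : ∀ j, 0 < ‖(a j)⁻¹‖ := fun j => norm_pos_iff.2 (inv_ne_zero (ha j))
  -- The parameters `1 / a_j` are bounded by their own norms, so the convergence condition is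
  -- exactly `hconv`.
  have hprod : ‖q‖ * ∏ j, ‖(a j)⁻¹‖ < 1 := by
    rw [← norm_prod, Finset.prod_inv_distrib, norm_inv, ← div_eq_mul_inv]
    exact (div_lt_one ((norm_nonneg q).trans_lt hconv)).2 hconv
  obtain ⟨u, hu, hle⟩ := exists_summable_norm_poisedTerm_le hq hq0 hpos hprod (inv_pos.2 hR) r⁻¹
  have hG : ContinuousOn (fun z => (1 - z ^ 2) / (2 * Real.pi * Complex.I * z) /
      ∏ j, qPochPair q (b j) z) (range γ) := by
    refine hγ.continuousOn_div hq fun z hz => ?_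
    have h2 : 2 * Real.pi * Complex.I * z ≠ 0 := mul_ne_zero Complex.two_pi_I_ne_zero hz
    fun_prop (disch := assumption)
  obtain ⟨M, hM⟩ := (isCompact_range γ.continuous).exists_bound_of_continuousOn hG
  have hsplit : ∀ m z, scaledIntegrand q (fun j => (a j)⁻¹) b m z =
      (1 - z ^ 2) / (2 * Real.pi * Complex.I * z) / (∏ j, qPochPair q (b j) z) *
        poisedTerm q (fun j => (a j)⁻¹) m z⁻¹ := fun m z => by
    rw [scaledIntegrand]
    ring
  have hs := hasSum_lineIntegral hγ.piecewiseC1Path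
    (F := scaledIntegrand q (fun j => (a j)⁻¹) b) (u := fun m => M * u m) (hu.mul_left M)
    (fun m => hγ.continuousOn_div hq
      fun z hz => differentiableAt_scaledNumerator hq hq0 (fun j => (a j)⁻¹) m hz)
    fun m z hz => by
      have h1 := hbd z hz
      have hzpos := hr.trans h1.1
      have hMz := hM z hz
      rw [hsplit, norm_mul]
      refine mul_le_mul hMz (hle m _ _ (fun _ => le_rfl) ?_ ?_) (norm_nonneg _)
        ((norm_nonneg _).trans hMz) <;> rw [norm_inv] <;> gcongr
      exacts [h1.2.le, h1.1.le]
  convert hs using 1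
  have hva : (fun j => (a j)⁻¹) = ![(a 0)⁻¹, (a 1)⁻¹, (a 2)⁻¹, (a 3)⁻¹] := by
    ext j
    fin_cases j <;> rfl
  have hvb : b = ![b 0, b 1, b 2, b 3] := by
    ext j
    fin_cases j <;> rfl
  set Pa := qPochInf (q * (a 0)⁻¹ * (a 1)⁻¹) q * qPochInf (q * (a 0)⁻¹ * (a 2)⁻¹) q *
    qPochInf (q * (a 0)⁻¹ * (a 3)⁻¹) q * (qPochInf (q * (a 1)⁻¹ * (a 2)⁻¹) q *
    qPochInf (q * (a 1)⁻¹ * (a 3)⁻¹) q * qPochInf (q * (a 2)⁻¹ * (a 3)⁻¹) q) with hPa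
  set Ka := qPochInf (q * (a 0)⁻¹ * (a 1)⁻¹ * (a 2)⁻¹ * (a 3)⁻¹) q with hKa
  have hKa' : qPochInf (q / ∏ j, a j) q = Ka := by
    rw [hKa, Fin.prod_univ_four]
    congr 1
    simp only [div_eq_mul_inv, mul_inv]
    ring
  have hKa0 : Ka ≠ 0 := by
    rw [← hKa']
    refine qPochInf_ne_zero_of_norm_lt_one hq ?_
    rw [norm_div]
    exact (div_lt_one ((norm_nonneg q).trans_lt hconv)).2 hconv
  -- Bailey's sum: on the contour the series is a constant times the theta function in the
  -- Askey–Wilson integrand.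
  have hsum : ∀ z ≠ 0, ∑' m, poisedTerm q (fun j => (a j)⁻¹) m z⁻¹ = Pa / Ka * poisedTheta q z := by
    intro z hz
    have := tsum_poisedTerm_eq hq hq0 (inv_ne_zero hz) (hpos 0) (hpos 1) (hpos 2) (hpos 3)
      (by simpa only [Fin.prod_univ_four] using hprod) le_rfl le_rfl le_rfl le_rfl
    rw [← hva] at this
    rw [div_mul_eq_mul_div, eq_div_iff hKa0, mul_comm]
    exact this
  have haw := lineIntegral_awIntegrand_eq hq hq0 (hvb ▸ hγ)
  rw [← hvb] at haw
  have hI := Complex.two_pi_I_ne_zero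
  have e : lineIntegral (fun z => ∑' m, scaledIntegrand q (fun j => (a j)⁻¹) b m z) γ =
      Pa / Ka / (2 * Real.pi * Complex.I) * lineIntegral (awIntegrand q b) γ := by
    rw [← lineIntegral_const_mul]
    refine lineIntegral_congr fun z hz => ?_
    simp only [hsplit]
    rw [tsum_mul_left, hsum z (hγ.ne_zero hz), awIntegrand]
    field_simp
  rw [e, prod_Ioi_fin_four, hKa', Fin.prod_univ_four b]
  have hb' : ∀ j k : Fin 4, qPochInf (b j * b k) q ≠ 0 := fun j k => qPochInf_ne_zero hq (hb j k)
  have h01 := hb' 0 1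
  have h02 := hb' 0 2
  have h03 := hb' 0 3
  have h12 := hb' 1 2
  have h13 := hb' 1 3
  have h23 := hb' 2 3
  have haw' : lineIntegral (awIntegrand q b) γ = qPochInf (b 0 * b 1 * b 2 * b 3) q *
      (2 * (2 * Real.pi * Complex.I)) / (qPochInf (b 0 * b 1) q * qPochInf (b 0 * b 2) q *
      qPochInf (b 0 * b 3) q * (qPochInf (b 1 * b 2) q * qPochInf (b 1 * b 3) q *
      qPochInf (b 2 * b 3) q)) := by
    rw [eq_div_iff (by simp only [ne_eq, mul_eq_zero, not_or]; tauto), mul_comm]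
    exact haw
  have hdiv : ∀ j k, q / (a j * a k) = q * (a j)⁻¹ * (a k)⁻¹ := fun j k => by
    rw [div_eq_mul_inv, mul_inv, mul_assoc]
  simp only [hdiv]
  rw [haw', hPa]
  generalize (2 * Real.pi * Complex.I : ℂ) = I at hI
  field_simp

end Assembly

theorem proposition2 (q s : ℂ) (hq0 : q ≠ 0) (hq1 : ‖q‖ < 1) (hs : s ^ 2 = q)
    (a b : Fin 4 → ℂ) (ha : ∀ j, a j ≠ 0) (hconv : ‖q‖ < ‖∏ j, a j‖)
    (hb : ∀ (j k : Fin 4) (n : ℕ), b j * b k * q ^ n ≠ 1) :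
    (∀ m : ℤ, ∃ (p : ℂ) (γ : Path p p),
      IsSeparatingContour γ (polesToZero q s b m) (polesToInfinity q s b m)) ∧
    ∀ (p : ℤ → ℂ) (γ : ∀ m : ℤ, Path (p m) (p m)),
      (∀ m : ℤ,
        IsSeparatingContour (γ m) (polesToZero q s b m) (polesToInfinity q s b m)) →
      HasSum
        (fun m : ℤ =>
          contourIntegral
            (fun z => wpIntegrand q s a b m z / (2 * (Real.pi : ℂ) * Complex.I * z)) (γ m))
        (2 * qPochInf (∏ j, b j) q / qPochInf (q / ∏ j, a j) q *
          ∏ j : Fin 4, ∏ k ∈ Finset.Ioi j,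
            qPochInf (q / (a j * a k)) q / qPochInf (b j * b k) q) := by
  have hs0 : s ≠ 0 := by
    rintro rfl
    exact hq0 (by rw [← hs]; ring)
  -- One contour for the unscaled poles gives all the others by scaling with `s ^ (-m)`, and it is
  -- also the common contour of integration.
  obtain ⟨p₀, γ₀, hγ₀⟩ := exists_isSeparatingContour_innerPoles hq1 hb
  refine ⟨fun m => ⟨_, γ₀.mulLeft (s ^ (-m)), hγ₀.mulLeft (zpow_ne_zero _ hs0)
    (mul_mem_polesToZero hs0 b m) (mul_mem_polesToInfinity hs0 b m)⟩, fun p γ hγ => ?_⟩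
  simp only [contourIntegral_wpIntegrand_eq hq1 hq0 hs ha _ (hγ _) hγ₀]
  exact hasSum_lineIntegral_scaledIntegrand hq1 hq0 ha hconv hb hγ₀
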